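/- Let $\mathrm{CGA}$ be the real Clifford algebra generated by $e_1,e_2,e_3,e_+,e_-$ with $e_1^2=e_2^2=e_3^2=e_+^2=1$, $e_-^2=-1$ and $e_ie_j=-e_je_i=:e_{ij}$ for $i\neq j$; let $\tilde{\ }$ denote reversion. A point $c\in\mathbb R^3$ is represented, up to non-zero real factors, by $c_1e_1+c_2e_2+c_3e_3+\tfrac12(1+\|c\|^2)(e_++e_-)-e_+$, and $\infty$ by $e_++e_-$. An element $b$ acts on points by $x\mapsto bx\tilde b$; conformal displacements are the products of an even number of vectors representing reflections in spheres (of positive radius) or planes. "Circle" means a Euclidean circle of positive radius or a straight line together with $\infty$. A Dupin cyclide is the image, under a conformal displacement, of a torus of revolution, a cylinder of revolution or a cone of revolution (the last two completed by $\infty$). A Villarceau circle of a ring torus of revolution is a circle on it that lies in a plane through its centre tangent to the torus at two different points; a circle $K$ on a surface $A$ is a Villarceau circle of $A$ if some conformal displacement maps $A$ to a ring torus of revolution and $K$ to a Villarceau circle of it. Let $C(t)=(t-e_{12})(t-e_{3+})$ be the conformal Villarceau motion and $m=\tfrac12(e_{12}+e_{3+})$. For a unit vector $w=(w_1,w_2,w_3)\in\mathbb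 R^3$ put $$S(w)=2w_1(e_{1+}-e_{23})+2w_2(e_{2+}+e_{13})+2w_3(e_{3+}-e_{12}),\qquad h_1=m-\tfrac14S(w),\quad h_2=m+\tfrac14S(w),$$ and $H_1(s)=s-h_1$, $H_2(t)=t-h_2$. (If $w=w(u,v)$ is a parametrization of the unit sphere these are $h_1(u,v)$, $h_2(u,v)$.) The parameters $s,t$ range over $\mathbb R\cup\{\infty\}$, the value of a polynomial at $\infty$ being its leading coefficient, here $1$. 1. For every unit vector $w$ and all $s,t$: $H_1(s)H_2(t)=H_2(t)H_1(s)$. 2. For every point $x\in\mathbb R^3\cup\{\infty\}$, the expression $C(t)\,x\,\tilde C(t)$ represents a point $\gamma(t)$ for each $t$, and the trajectory $\{\gamma(t)\}$ is a circle. For every unit vector $w$ the expression $H_1(s)H_2(t)\,x\,\tilde H_2(t)\tilde H_1(s)$ represents a point $D(s,t)$ for all $s,t$, and $D(t,t)=\gamma(t)$ for all $t$. Thus the diagonal $s=t$ is the same circle for all $w$. 3. Suppose moreover that $x$ is fixed neither by the whole elementary motion $H_1$ nor by the whole elementary motion $H_2$. Then the trajectory surface $D_x=\{D(s,t)\}$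 satisfies the following. - All parameter lines ($t$ fixed, or $s$ fixed) are circles. - Near every $(s,t)\in\mathbb R^2$ with $D(s,t)\neq\infty$, $D$ is a smooth regular parametrized surface in $\mathbb R^3$, and its first and second fundamental forms are diagonal there. - $D_x$ is a Dupin cyclide. - The trajectory $\{\gamma(t)\}$ is a Villarceau circle of $D_x$. - If the trajectory surface of $x$ for another unit vector $w'$ is the same point set, then $w'=\pm w$. -/

import Mathlib

open scoped RealInnerProductSpace ContDiff

noncomputable section

namespace Villarceau

/-- Euclidean three-space. -/
abbrev E3 : Type := EuclideanSpace ℝ (Fin 3)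

/-- The quadratic form of signature `(4, 1)` on `ℝ⁵`; the indices `0, 1, 2, 3, 4` stand for
`e₁, e₂, e₃, e₊, e₋`. -/
def Q : QuadraticForm ℝ (Fin 5 → ℝ) :=
  QuadraticMap.weightedSumSquares ℝ (![1, 1, 1, 1, -1] : Fin 5 → ℝ)

/-- Conformal geometric algebra of three-space. -/
abbrev CGA : Type := CliffordAlgebra Q

/-- The generators `e₁, e₂, e₃, e₊, e₋`. -/
def e (i : Fin 5) : CGA := CliffordAlgebra.ι Q (Pi.single i 1)

/-- Reversion. -/
def rev (a : CGA) : CGA := CliffordAlgebra.reverse a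

/-! ### Spheres, planes, points, and the sandwich action -/

/-- The vector of the sphere with centre `c` and radius `r`. -/
def sphereVec (c : E3) (r : ℝ) : CGA :=
  c 0 • e 0 + c 1 • e 1 + c 2 • e 2 + ((1 + ‖c‖ ^ 2 - r ^ 2) / 2) • (e 3 + e 4) - e 3

/-- The vector of the plane with unit normal `n` and oriented distance `d` from the origin. -/
def planeVec (n : E3) (d : ℝ) : CGA :=
  n 0 • e 0 + n 1 • e 1 + n 2 • e 2 + d • (e 3 + e 4)

/-- The null vector of a point of conformal three-space `ℝ³ ∪ {∞}`: finite points are spheres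
of radius zero. -/
def pt (x : OnePoint E3) : CGA := x.elim (e 3 + e 4) fun c => sphereVec c 0

/-- `a` is a homogeneous coordinate vector of the point `x`. -/
def Represents (a : CGA) (x : OnePoint E3) : Prop := ∃ k : ℝ, k ≠ 0 ∧ a = k • pt x

/-- The transformation `x ↦ b x b̃` maps the point `x` to the point `y`. -/
def MapsPoint (b : CGA) (x y : OnePoint E3) : Prop := Represents (b * pt x * rev b) y

/-- The image of a point set under `x ↦ b x b̃`. -/
def imageUnder (b : CGA) (A : Set (OnePoint E3)) : Set (OnePoint E3) :=
  {y | ∃ x ∈ A, MapsPoint b x y}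

/-- Homogeneous coordinates of a sphere (of positive radius) or a plane. -/
def IsMirror (a : CGA) : Prop :=
  ∃ k : ℝ, k ≠ 0 ∧
    ((∃ (c : E3) (r : ℝ), 0 < r ∧ a = k • sphereVec c r) ∨
      (∃ (n : E3) (d : ℝ), ‖n‖ = 1 ∧ a = k • planeVec n d))

/-- Conformal displacements: compositions of an even number of reflections in spheres or
planes. -/
def IsConformalDisplacement (b : CGA) : Prop :=
  ∃ l : List CGA, Even l.length ∧ (∀ a ∈ l, IsMirror a) ∧ b = l.prod

/-! ### The Villarceau motion and its factorizations -/

/-- The linear polynomial `t - h` as a function of `t ∈ ℝ ∪ {∞}`. Values matter only up to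
non-zero real factors; at `t = ∞` the value is the leading coefficient. -/
def linearMotion (h : CGA) (t : OnePoint ℝ) : CGA :=
  t.elim 1 fun τ => algebraMap ℝ CGA τ - h

/-- The Villarceau motion `C = (t - e₁₂)(t - e₃₊)`. -/
def C (t : OnePoint ℝ) : CGA := linearMotion (e 0 * e 1) t * linearMotion (e 2 * e 3) t

/-- The centre `m` of the sphere of factors. -/
def m : CGA := (1 / 2 : ℝ) • (e 0 * e 1 + e 2 * e 3)

/-- The combination `w₀ s_x + w₁ s_y + w₂ s_z`, where `s_x = 2(e₁₊ - e₂₃)`,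
`s_y = 2(e₂₊ + e₁₃)`, `s_z = 2(e₃₊ - e₁₂)`; for unit vectors `w` it runs through the sphere
called `S(u, v)`. -/
def S (w : E3) : CGA :=
  w 0 • ((2 : ℝ) • (e 0 * e 3 - e 1 * e 2)) + w 1 • ((2 : ℝ) • (e 1 * e 3 + e 0 * e 2)) +
    w 2 • ((2 : ℝ) • (e 2 * e 3 - e 0 * e 1))

/-- The left factor is `t - h₁`. -/
def h₁ (w : E3) : CGA := m - (1 / 4 : ℝ) • S w

/-- The right factor is `t - h₂`. -/
def h₂ (w : E3) : CGA := m + (1 / 4 : ℝ) • S w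

/-- `x` is fixed by the whole elementary motion `t - h`. -/
def IsFixedPoint (h : CGA) (x : OnePoint E3) : Prop :=
  ∀ t : OnePoint ℝ, MapsPoint (linearMotion h t) x x

/-- `γ` is the trajectory of `x` under `C`. -/
def IsTrajectory (x : OnePoint E3) (γ : OnePoint ℝ → OnePoint E3) : Prop :=
  ∀ t, Represents (C t * pt x * rev (C t)) (γ t)

/-- `D` is the two-parametric trajectory surface `H₁ H₂ x H̃₂ H̃₁` of `x`, where
`H₁ = s - h₁`, `H₂ = t - h₂`. -/
def IsTrajectorySurface (w : E3) (x : OnePoint E3)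
    (D : OnePoint ℝ → OnePoint ℝ → OnePoint E3) : Prop :=
  ∀ s t, Represents
    (linearMotion (h₁ w) s * linearMotion (h₂ w) t * pt x *
      rev (linearMotion (h₂ w) t) * rev (linearMotion (h₁ w) s)) (D s t)

/-- The set of points of a surface. -/
def carrier (D : OnePoint ℝ → OnePoint ℝ → OnePoint E3) : Set (OnePoint E3) :=
  Set.range fun p : OnePoint ℝ × OnePoint ℝ => D p.1 p.2

/-! ### Circles -/

/-- Circles (of positive radius) in Euclidean three-space. -/
def IsEuclideanCircle (K : Set E3) : Prop :=
  ∃ (c n : E3) (r : ℝ), ‖n‖ = 1 ∧ 0 < r ∧ K = {p | dist p c = r ∧ ⟪p - c, n⟫ = 0}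

/-- Circles of conformal three-space: Euclidean circles, and straight lines completed by `∞`. -/
def IsCircle (K : Set (OnePoint E3)) : Prop :=
  (∃ K₀ : Set E3, IsEuclideanCircle K₀ ∧ K = (↑) '' K₀) ∨
    ∃ p v : E3, v ≠ 0 ∧
      K = insert OnePoint.infty ((↑) '' (Set.range fun a : ℝ => p + a • v))

/-! ### Dupin cyclides and Villarceau circles -/

/-- The point at angle `θ` on the circle of radius `r` with centre `c + R d` in the plane
through `c` spanned by `d` and `n`. -/
def torusPoint (c n : E3) (R r : ℝ) (d : E3) (θ : ℝ) : E3 :=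
  c + (R + r * Real.cos θ) • d + (r * Real.sin θ) • n

/-- The torus of revolution with centre `c`, axis direction `n` (a unit vector), and radii
`R`, `r`: such a circle is rotated about the axis. -/
def torus (c n : E3) (R r : ℝ) : Set E3 :=
  {p | ∃ (d : E3) (θ : ℝ), ‖d‖ = 1 ∧ ⟪d, n⟫ = 0 ∧ p = torusPoint c n R r d θ}

/-- The cylinder of revolution with radius `r`. -/
def cylinder (c n : E3) (r : ℝ) : Set E3 := {p | ‖p - c‖ ^ 2 - ⟪p - c, n⟫ ^ 2 = r ^ 2}

/-- The double cone of revolution with apex `c` whose rulings form the angle `α` with the axis. -/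
def cone (c n : E3) (α : ℝ) : Set E3 := {p | |⟪p - c, n⟫| = ‖p - c‖ * Real.cos α}

/-- Dupin cyclides: conformal images of tori, cylinders, and cones of revolution. -/
def IsDupinCyclide (A : Set (OnePoint E3)) : Prop :=
  ∃ b : CGA, IsConformalDisplacement b ∧ ∃ c n : E3, ‖n‖ = 1 ∧
    ((∃ R r : ℝ, 0 < R ∧ 0 < r ∧ imageUnder b A = (↑) '' torus c n R r) ∨
      (∃ r : ℝ, 0 < r ∧ imageUnder b A = insert OnePoint.infty ((↑) '' cylinder c n r)) ∨
      (∃ α : ℝ, 0 < α ∧ α < Real.pi / 2 ∧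
        imageUnder b A = insert OnePoint.infty ((↑) '' cone c n α)))

/-- `P` is the tangent plane of the torus at its point `p`. -/
def IsTorusTangentPlane (c n : E3) (R r : ℝ) (p : E3) (P : Set E3) : Prop :=
  ∃ (d : E3) (θ : ℝ), ‖d‖ = 1 ∧ ⟪d, n⟫ = 0 ∧ p = torusPoint c n R r d θ ∧
    P = {y | ⟪y - p, Real.cos θ • d + Real.sin θ • n⟫ = 0}

/-- Villarceau circles of a ring torus (`0 < r < R`): circles on the torus that lie in a plane
through its centre which is tangent to the torus at two different points. -/
def IsTorusVillarceauCircle (c n : E3) (R r : ℝ) (K : Set E3) : Prop :=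
  IsEuclideanCircle K ∧ K ⊆ torus c n R r ∧
    ∃ P : Set E3, c ∈ P ∧ K ⊆ P ∧
      ∃ p q : E3, p ≠ q ∧ IsTorusTangentPlane c n R r p P ∧ IsTorusTangentPlane c n R r q P

/-- `K` is a Villarceau circle on the surface `A`: a conformal displacement maps `A` to a ring
torus and `K` to a Villarceau circle of that torus. -/
def IsVillarceauCircleOn (A K : Set (OnePoint E3)) : Prop :=
  ∃ b : CGA, IsConformalDisplacement b ∧ ∃ (c n : E3) (R r : ℝ) (K₀ : Set E3),
    ‖n‖ = 1 ∧ 0 < r ∧ r < R ∧ imageUnder b A = (↑) '' torus c n R r ∧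
      IsTorusVillarceauCircle c n R r K₀ ∧ imageUnder b K = (↑) '' K₀

/-! ### Fundamental forms of parametrized surfaces -/

/-- The two partial derivatives of a parametrized surface (or of a vector field along it). -/
def partialDeriv (i : Fin 2) (f : ℝ × ℝ → E3) (p : ℝ × ℝ) : E3 :=
  fderiv ℝ f p ((![(1, 0), (0, 1)] : Fin 2 → ℝ × ℝ) i)

/-- The unit normal, in the direction of the cross product of the partial derivatives. -/
def unitNormal (f : ℝ × ℝ → E3) (p : ℝ × ℝ) : E3 :=
  let N : E3 := WithLp.toLp 2
    (crossProduct (WithLp.ofLp (partialDeriv 0 f p)) (WithLp.ofLp (partialDeriv 1 f p)))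
  ‖N‖⁻¹ • N

/-- The matrix of the first fundamental form. -/
def firstForm (f : ℝ × ℝ → E3) (p : ℝ × ℝ) : Matrix (Fin 2) (Fin 2) ℝ :=
  Matrix.of fun i j => ⟪partialDeriv i f p, partialDeriv j f p⟫

/-- The matrix of the second fundamental form. -/
def secondForm (f : ℝ × ℝ → E3) (p : ℝ × ℝ) : Matrix (Fin 2) (Fin 2) ℝ :=
  Matrix.of fun i j => ⟪partialDeriv i (partialDeriv j f) p, unitNormal f p⟫

/-- A surface in conformal three-space as a parametrized surface in Euclidean three-space; the
value is meaningful where `D s t ≠ ∞`. -/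
def euclideanChart (D : OnePoint ℝ → OnePoint ℝ → OnePoint E3) (p : ℝ × ℝ) : E3 :=
  (D (p.1 : OnePoint ℝ) (p.2 : OnePoint ℝ)).elim 0 id

end Villarceau

end

/-!
The elements `e₁₂`, `e₃₊`, `h₁ w` and `h₂ w` fix `e₋`, so all motions are rotations of the
three-sphere in `ℝ⁴ = ⟨e₁, e₂, e₃, e₊⟩`, which is conformal three-space via stereographic projection
(`represents_smul_vec`, `ActsBy.mapsPoint`). In quaternion terms the commutator with `m` is a left
multiplication `opU`, and the commutator with `S(w)` is, up to a factor, the right multiplication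
`opW w` by an imaginary unit. These two complex structures commute. Hence `h₁ w` and `h₂ w` are
commuting unit bivectors of two orthogonal planes, on which `opW w = -opU` and `opW w = opU`
respectively, and `t - h₁ w`, `t - h₂ w` are the rotations in these planes (`IsRotor.sandwich`,
`isRotor_h₁`).

Consequently the trajectory of `p` under the Villarceau motion is the great circle spanned by `p`
and `opU p`, a fibre of the Hopf map (`hopf`), while the trajectory surface is a Clifford torus
`a(s) + b(t)` with circles `a`, `b` in the two planes. The latter is the preimage under the Hopf map
of the circle of latitude through `hopf p` with axis `w` (`carrier_eq`). All assertions follow from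
this picture.

* Circles are the sections of the three-sphere by two-planes (`isCircle_setOf`).
* A translation surface `a(s) + b(t)` has vanishing mixed derivative, so the mixed derivative of its
  stereographic image is tangential. Since stereographic projection is conformal, both fundamental
  forms are diagonal (`stereoSum_regular`).
* Right multiplications commute with the Villarceau motion, are conformal displacements, and rotate
  the Hopf sphere; so `w` may be turned into `e₃` (`exists_displacement`). Then the surface is the
  torus of revolution given by `hopf y 2 = a ^ 2 - b ^ 2`, with radii `1 / a` and `b / a`
  (`setOf_hopf_eq`), and a Hopf fibre lies in a plane through the origin that touches the torus in
  two opposite points (`isTorusVillarceauCircle`).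
* A circle of latitude of positive radius determines its axis up to sign (`axis_unique`), and the
  Hopf map is surjective.
-/

noncomputable section

namespace Villarceau

open scoped Matrix

/-! ### The Clifford algebra -/

/-- The orthogonal complement of `e₋`, with coordinates along `e₁, e₂, e₃, e₊`. -/
abbrev R4 : Type := Fin 4 → ℝ

/-- The vector `p + z e₋` of the Clifford algebra. -/
def vec (p : R4) (z : ℝ) : CGA := CliffordAlgebra.ι Q ![p 0, p 1, p 2, p 3, z]

lemma vec_add (p q : R4) (y z : ℝ) : vec p y + vec q z = vec (p + q) (y + z) := by
  simp only [vec, ← map_add]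
  congr 1
  ext i; fin_cases i <;> simp

lemma vec_sub (p q : R4) (y z : ℝ) : vec p y - vec q z = vec (p - q) (y - z) := by
  simp only [vec, ← map_sub]
  congr 1
  ext i; fin_cases i <;> simp

lemma smul_vec (k : ℝ) (p : R4) (z : ℝ) : k • vec p z = vec (k • p) (k * z) := by
  simp only [vec, ← map_smul]
  congr 1
  ext i; fin_cases i <;> simp

lemma vec_eq (p : R4) (z : ℝ) :
    vec p z = p 0 • e 0 + p 1 • e 1 + p 2 • e 2 + p 3 • e 3 + z • e 4 := by
  simp only [vec, e, ← map_smul, ← map_add]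
  congr 1
  ext i; fin_cases i <;> simp

lemma Q_apply (v : Fin 5 → ℝ) :
    Q v = v 0 * v 0 + v 1 * v 1 + v 2 * v 2 + v 3 * v 3 - v 4 * v 4 := by
  simp [Q, QuadraticMap.weightedSumSquares_apply, Fin.sum_univ_five]
  ring

lemma vec_injective {p q : R4} {y z : ℝ} (h : vec p y = vec q z) : p = q ∧ y = z := by
  have hinj : Function.Injective (CliffordAlgebra.ι Q) := by
    intro a b hab
    have := congrArg (CliffordAlgebra.equivExterior Q) hab
    simp only [CliffordAlgebra.equivExterior, CliffordAlgebra.changeFormEquiv_apply,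
      CliffordAlgebra.changeForm_ι] at this
    exact ExteriorAlgebra.ι_leftInverse.injective this
  have h' := hinj h
  refine ⟨?_, by simpa using congrFun h' 4⟩
  ext i
  fin_cases i
  · simpa using congrFun h' 0
  · simpa using congrFun h' 1
  · simpa using congrFun h' 2
  · simpa using congrFun h' 3

lemma e_mul_self (i : Fin 5) :
    e i * e i = algebraMap ℝ CGA ((![1, 1, 1, 1, -1] : Fin 5 → ℝ) i) := by
  rw [e, CliffordAlgebra.ι_sq_scalar, Q_apply]
  fin_cases i <;> simp

lemma e_mul_swap {i j : Fin 5} (h : i ≠ j) : e j * e i = -(e i * e j) := by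
  rw [eq_neg_iff_add_eq_zero, e, e, CliffordAlgebra.ι_mul_ι_add_swap, QuadraticMap.polar]
  simp only [Q_apply]
  rw [← map_zero (algebraMap ℝ CGA)]
  congr 1
  fin_cases i <;> fin_cases j <;> first | exact absurd rfl h | simp

lemma e_mul_self_left {i : Fin 5} (hi : i ≠ 4) (a : CGA) : e i * (e i * a) = a := by
  rw [← mul_assoc, e_mul_self]
  fin_cases i <;> simp at hi ⊢

lemma e_mul_self' {i : Fin 5} (hi : i ≠ 4) : e i * e i = 1 := by
  rw [e_mul_self]
  fin_cases i <;> simp at hi ⊢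

lemma e_mul_swap_left {i j : Fin 5} (h : i < j) (a : CGA) :
    e j * (e i * a) = -(e i * (e j * a)) := by
  rw [← mul_assoc, e_mul_swap h.ne, neg_mul, mul_assoc]

lemma e_mul_swap' {i j : Fin 5} (h : i < j) : e j * e i = -(e i * e j) := e_mul_swap h.ne

lemma rev_e (i : Fin 5) : rev (e i) = e i := CliffordAlgebra.reverse_ι _

lemma rev_mul (a b : CGA) : rev (a * b) = rev b * rev a := CliffordAlgebra.reverse.map_mul a b

/-- The complex structure `x ↦ [x, m]` of `ℝ⁴`. In quaternion terms it is a left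
multiplication by an imaginary unit. -/
def opU : R4 →ₗ[ℝ] R4 where
  toFun p := ![-p 1, p 0, -p 3, p 2]
  map_add' p q := by ext i; fin_cases i <;> simp <;> ring
  map_smul' k p := by ext i; fin_cases i <;> simp

/-- The complex structure `x ↦ [x, S(w)] / 4` of `ℝ⁴`, for a unit vector `w`. In quaternion terms
it is the right multiplication by the imaginary unit with coordinates `w`. -/
def opW (w : E3) : R4 →ₗ[ℝ] R4 where
  toFun p := ![-(w 0 * p 3) - w 1 * p 2 + w 2 * p 1, w 0 * p 2 - w 1 * p 3 - w 2 * p 0,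
    -(w 0 * p 1) + w 1 * p 0 - w 2 * p 3, w 0 * p 0 + w 1 * p 1 + w 2 * p 2]
  map_add' p q := by ext i; fin_cases i <;> simp <;> ring
  map_smul' k p := by ext i; fin_cases i <;> simp <;> ring

/-- Half the commutator with `h₁ w`. -/
def rot₁ (w : E3) : R4 →ₗ[ℝ] R4 := (1 / 2 : ℝ) • (opU - opW w)

/-- Half the commutator with `h₂ w`. -/
def rot₂ (w : E3) : R4 →ₗ[ℝ] R4 := (1 / 2 : ℝ) • (opU + opW w)

/-- `B` has the properties of a bivector of square `-1`, so that the elements `c + s B` represent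
rotations, and `j` is half the commutator with `B`, as a map of `ℝ⁴`. -/
structure IsRotor (B : CGA) (j : R4 → R4) : Prop where
  sq : B * B = -1
  rev_eq : rev B = -B
  comm : ∀ p z, vec p z * B - B * vec p z = (2 : ℝ) • vec (j p) 0

/-- The formula rests on `B v B = -v - 2 j (j v)`, which follows by moving the left factor `B` to
the right, or the right factor to the left, and averaging. -/
lemma IsRotor.sandwich {B : CGA} {j : R4 → R4} (h : IsRotor B j) (c s : ℝ) (p : R4) (z : ℝ) :
    (algebraMap ℝ CGA c + s • B) * vec p z * rev (algebraMap ℝ CGA c + s • B) =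
      vec ((c ^ 2 + s ^ 2) • p - (2 * c * s) • j p + (2 * s ^ 2) • j (j p))
        ((c ^ 2 + s ^ 2) * z) := by
  have hrev : rev (algebraMap ℝ CGA c + s • B) = algebraMap ℝ CGA c - s • B := by
    have := h.rev_eq
    simp only [rev] at this ⊢
    rw [map_add, CliffordAlgebra.reverse.commutes, map_smul, this, smul_neg, sub_eq_add_neg]
  have hsplit : vec ((c ^ 2 + s ^ 2) • p - (2 * c * s) • j p + (2 * s ^ 2) • j (j p))
        ((c ^ 2 + s ^ 2) * z) =
      (c ^ 2 + s ^ 2) • vec p z - (2 * c * s) • vec (j p) 0 + (2 * s ^ 2) • vec (j (j p)) 0 := by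
    simp only [smul_vec, vec_sub, vec_add, mul_zero, sub_zero, add_zero]
  have h1 : vec p z * B = B * vec p z + (2 : ℝ) • vec (j p) 0 :=
    sub_eq_iff_eq_add'.mp (h.comm p z)
  have h2 : vec (j p) 0 * B = B * vec (j p) 0 + (2 : ℝ) • vec (j (j p)) 0 :=
    sub_eq_iff_eq_add'.mp (h.comm (j p) 0)
  have h3 : B * vec p z * B = -vec p z - (2 : ℝ) • vec (j (j p)) 0 := by
    have e1 : B * vec p z * B = -vec p z + (2 : ℝ) • (B * vec (j p) 0) := by
      rw [mul_assoc, h1, mul_add, ← mul_assoc, h.sq, mul_smul_comm, neg_one_mul]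
    have e2 : B * vec p z * B = -vec p z - (2 : ℝ) • (vec (j p) 0 * B) := by
      rw [eq_sub_of_add_eq h1.symm, sub_mul, mul_assoc, h.sq, smul_mul_assoc, mul_neg_one]
    rw [h2] at e2
    have : (2 : ℝ) • (B * vec p z * B) =
        (2 : ℝ) • (-vec p z - (2 : ℝ) • vec (j (j p)) 0) := by
      rw [two_smul]
      nth_rewrite 1 [e1]
      rw [e2]
      module
    exact smul_right_injective CGA (two_ne_zero' ℝ) this
  rw [hrev, hsplit]
  simp only [Algebra.algebraMap_eq_smul_one, add_mul, mul_sub, smul_mul_assoc, mul_smul_comm,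
    one_mul, mul_one, h3, h1]
  module

lemma opU_opU (p : R4) : opU (opU p) = -p := by
  ext i; fin_cases i <;> simp [opU]

lemma opU_opW (w : E3) (p : R4) : opU (opW w p) = opW w (opU p) := by
  ext i; fin_cases i <;> simp [opU, opW] <;> ring

lemma norm_sq_E3 (v : E3) : ‖v‖ ^ 2 = v 0 ^ 2 + v 1 ^ 2 + v 2 ^ 2 := by
  simp [EuclideanSpace.norm_sq_eq, Fin.sum_univ_three]

lemma opW_opW {w : E3} (hw : ‖w‖ = 1) (p : R4) : opW w (opW w p) = -p := by
  have h := norm_sq_E3 w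
  rw [hw] at h
  ext i; fin_cases i <;> simp [opW]
  · linear_combination p 0 * h
  · linear_combination p 1 * h
  · linear_combination p 2 * h
  · linear_combination p 3 * h

/-- Rewrite rules that bring products of the generators into increasing order. -/
lemma e_normal_order :
    (e 0 * e 0 = 1 ∧ e 1 * e 1 = 1 ∧ e 2 * e 2 = 1 ∧ e 3 * e 3 = 1) ∧
    (e 1 * e 0 = -(e 0 * e 1) ∧ e 2 * e 0 = -(e 0 * e 2) ∧ e 3 * e 0 = -(e 0 * e 3) ∧
      e 4 * e 0 = -(e 0 * e 4) ∧ e 2 * e 1 = -(e 1 * e 2) ∧ e 3 * e 1 = -(e 1 * e 3) ∧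
      e 4 * e 1 = -(e 1 * e 4) ∧ e 3 * e 2 = -(e 2 * e 3) ∧ e 4 * e 2 = -(e 2 * e 4) ∧
      e 4 * e 3 = -(e 3 * e 4)) ∧
    (∀ a, e 0 * (e 0 * a) = a ∧ e 1 * (e 1 * a) = a ∧ e 2 * (e 2 * a) = a ∧
      e 3 * (e 3 * a) = a) ∧
    (∀ a, e 1 * (e 0 * a) = -(e 0 * (e 1 * a)) ∧ e 2 * (e 0 * a) = -(e 0 * (e 2 * a)) ∧
      e 3 * (e 0 * a) = -(e 0 * (e 3 * a)) ∧ e 4 * (e 0 * a) = -(e 0 * (e 4 * a)) ∧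
      e 2 * (e 1 * a) = -(e 1 * (e 2 * a)) ∧ e 3 * (e 1 * a) = -(e 1 * (e 3 * a)) ∧
      e 4 * (e 1 * a) = -(e 1 * (e 4 * a)) ∧ e 3 * (e 2 * a) = -(e 2 * (e 3 * a)) ∧
      e 4 * (e 2 * a) = -(e 2 * (e 4 * a)) ∧ e 4 * (e 3 * a) = -(e 3 * (e 4 * a))) := by
  refine ⟨⟨?_, ?_, ?_, ?_⟩, ⟨?_, ?_, ?_, ?_, ?_, ?_, ?_, ?_, ?_, ?_⟩,
    fun a => ⟨?_, ?_, ?_, ?_⟩, fun a => ⟨?_, ?_, ?_, ?_, ?_, ?_, ?_, ?_, ?_, ?_⟩⟩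
  all_goals first
    | exact e_mul_self' (by decide)
    | exact e_mul_self_left (by decide) a
    | exact e_mul_swap' (by decide)
    | exact e_mul_swap_left (by decide) a

lemma isRotor_e_mul_e {i k : Fin 5} (hik : i < k) (hk : k ≠ 4) {j : R4 → R4}
    (hj : ∀ p z, vec p z * (e i * e k) - e i * e k * vec p z = (2 : ℝ) • vec (j p) 0) :
    IsRotor (e i * e k) j where
  sq := by
    have hi : i ≠ 4 := by omega
    rw [mul_assoc, e_mul_swap_left hik, e_mul_self' hk, mul_neg, mul_one, e_mul_self' hi]
  rev_eq := by rw [rev_mul, rev_e, rev_e, e_mul_swap hik.ne]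
  comm := hj


lemma isRotor_e01 : IsRotor (e 0 * e 1) fun p => ![-p 1, p 0, 0, 0] :=
  isRotor_e_mul_e (by decide) (by decide) fun p z => by
    simp [vec_eq, add_mul, mul_add, mul_assoc, e_normal_order]
    module

lemma isRotor_e23 : IsRotor (e 2 * e 3) fun p => ![0, 0, -p 3, p 2] :=
  isRotor_e_mul_e (by decide) (by decide) fun p z => by
    simp [vec_eq, add_mul, mul_add, mul_assoc, e_normal_order]
    module

lemma isRotor_e13 : IsRotor (e 1 * e 3) fun p => ![0, -p 3, 0, p 1] :=
  isRotor_e_mul_e (by decide) (by decide) fun p z => by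
    simp [vec_eq, add_mul, mul_add, mul_assoc, e_normal_order]
    module

lemma isRotor_e02 : IsRotor (e 0 * e 2) fun p => ![-p 2, 0, p 0, 0] :=
  isRotor_e_mul_e (by decide) (by decide) fun p z => by
    simp [vec_eq, add_mul, mul_add, mul_assoc, e_normal_order]
    module

lemma isRotor_h₁ {w : E3} (hw : ‖w‖ = 1) : IsRotor (h₁ w) (rot₁ w) := by
  have hh := norm_sq_E3 w
  rw [hw] at hh
  refine ⟨?_, ?_, fun p z => ?_⟩
  · simp [h₁, m, S, add_mul, mul_add, sub_mul, mul_sub, mul_assoc, e_normal_order, smul_smul,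
      smul_sub, smul_add]
    match_scalars
    · linear_combination (1 / 2) * hh
    · linear_combination (1 / 2) * hh
    all_goals ring
  · have hr : ∀ i j : Fin 5, CliffordAlgebra.reverse (e i * e j) = e j * e i := fun i j => by
      rw [CliffordAlgebra.reverse.map_mul]
      exact congrArg₂ _ (rev_e j) (rev_e i)
    simp only [rev, h₁, m, S, map_sub, map_add, map_smul, hr]
    simp only [e_normal_order]
    module
  · simp only [vec_eq, h₁, m, S, add_mul, mul_add, sub_mul, mul_sub, mul_assoc, e_normal_order,
      smul_mul_assoc, mul_smul_comm, mul_neg]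
    simp [rot₁, opU, opW]
    match_scalars <;> ring

lemma h₂_eq (w : E3) : h₂ w = h₁ (-w) := by
  simp only [h₁, h₂, S, PiLp.neg_apply]
  module

lemma rot₂_eq (w : E3) : rot₂ w = rot₁ (-w) := by
  ext p i
  fin_cases i <;> simp [rot₁, rot₂, opU, opW] <;> ring

lemma isRotor_h₂ {w : E3} (hw : ‖w‖ = 1) : IsRotor (h₂ w) (rot₂ w) := by
  rw [h₂_eq, rot₂_eq]
  exact isRotor_h₁ (by simpa using hw)

lemma h₁_mul_h₂ (w : E3) : h₁ w * h₂ w = h₂ w * h₁ w := by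
  simp [h₁, h₂, m, S, add_mul, mul_add, sub_mul, mul_sub, mul_assoc, e_normal_order, smul_smul,
    smul_sub, smul_add]
  module

lemma linearMotion_comm {a b : CGA} (h : a * b = b * a) (s t : OnePoint ℝ) :
    linearMotion a s * linearMotion b t = linearMotion b t * linearMotion a s := by
  induction s using OnePoint.rec with
  | infty => simp [linearMotion]
  | coe s =>
    induction t using OnePoint.rec with
    | infty => simp [linearMotion]
    | coe t =>
      simp only [linearMotion, OnePoint.elim_some]
      simp only [sub_mul, mul_sub, h, Algebra.algebraMap_eq_smul_one, smul_mul_assoc, one_mul,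
        mul_smul_comm, mul_one]
      module

/-! ### The rational parametrization of the circle -/

/-- The factor by which the sandwich with `t - h` scales vectors. -/
def scale (t : OnePoint ℝ) : ℝ := t.elim 1 fun τ => τ ^ 2 + 1

/-- The cosine of the rotation angle of the motion `t - h`. -/
def cosine (t : OnePoint ℝ) : ℝ := t.elim 1 fun τ => (τ ^ 2 - 1) / (τ ^ 2 + 1)

/-- The sine of the rotation angle of the motion `t - h`. -/
def sine (t : OnePoint ℝ) : ℝ := t.elim 0 fun τ => 2 * τ / (τ ^ 2 + 1)

lemma scale_pos (t : OnePoint ℝ) : 0 < scale t := by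
  induction t using OnePoint.rec with
  | infty => simp [scale]
  | coe t => simp only [scale, OnePoint.elim_some]; positivity

lemma cosine_sq_add_sine_sq (t : OnePoint ℝ) : cosine t ^ 2 + sine t ^ 2 = 1 := by
  induction t using OnePoint.rec with
  | infty => simp [cosine, sine]
  | coe t =>
    simp only [cosine, sine, OnePoint.elim_some]
    field_simp
    ring

lemma exists_cosine_sine {c s : ℝ} (h : c ^ 2 + s ^ 2 = 1) :
    ∃ t : OnePoint ℝ, cosine t = c ∧ sine t = s := by
  by_cases hc : c = 1
  · refine ⟨OnePoint.infty, by simp [cosine, hc], ?_⟩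
    have : s = 0 := by
      rw [hc] at h
      exact pow_eq_zero_iff two_ne_zero |>.mp (by linarith)
    simp [sine, this]
  · -- stereographic projection of the circle from `(1, 0)`
    refine ⟨((s / (1 - c) : ℝ) : OnePoint ℝ), ?_, ?_⟩
    all_goals
      have hc' : 1 - c ≠ 0 := fun h => hc (by linarith)
      have e1 : (s / (1 - c)) ^ 2 + 1 = 2 / (1 - c) := by
        field_simp
        linear_combination h
      simp only [cosine, sine, OnePoint.elim_some, e1]
    · have e2 : (s / (1 - c)) ^ 2 - 1 = 2 * c / (1 - c) := by
        rw [show (s / (1 - c)) ^ 2 - 1 = 2 / (1 - c) - 2 by linarith]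
        field_simp
        ring
      rw [e2]
      field_simp
    · field_simp

/-- The rotation with angle of cosine `c` and sine `s` in the plane on which `j ^ 2 = -1`, the
orthogonal complement of the plane being the kernel of `j`. -/
def rotate (j : R4 → R4) (c s : ℝ) (p : R4) : R4 := p + s • j p + (1 - c) • j (j p)

lemma IsRotor.linearMotion_sandwich {B : CGA} {j : R4 → R4} (h : IsRotor B j) (t : OnePoint ℝ)
    (p : R4) (z : ℝ) :
    linearMotion B t * vec p z * rev (linearMotion B t) =
      scale t • vec (rotate j (cosine t) (sine t) p) z := by
  induction t using OnePoint.rec with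
  | infty =>
    have : rev (1 : CGA) = 1 := CliffordAlgebra.reverse.map_one
    simp [linearMotion, scale, rotate, cosine, sine, this]
  | coe t =>
    have := h.sandwich t (-1) p z
    rw [neg_one_smul, ← sub_eq_add_neg] at this
    simp only [linearMotion, OnePoint.elim_some, this, scale, smul_vec]
    congr 1
    · simp only [rotate, cosine, sine, OnePoint.elim_some]
      match_scalars <;> (field_simp; try ring)
    · ring

/-! ### The three-sphere as a model of conformal space -/

lemma dot_eq (p q : R4) : p ⬝ᵥ q = p 0 * q 0 + p 1 * q 1 + p 2 * q 2 + p 3 * q 3 := by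
  simp [dotProduct, Fin.sum_univ_four]

lemma dot_self_eq_zero {p : R4} : p ⬝ᵥ p = 0 ↔ p = 0 := dotProduct_self_eq_zero

/-- Inverse stereographic projection from the pole `e₊`, which corresponds to `∞`. -/
def sph (x : OnePoint E3) : R4 :=
  x.elim ![0, 0, 0, 1] fun c =>
    ![2 * c 0 / (1 + ‖c‖ ^ 2), 2 * c 1 / (1 + ‖c‖ ^ 2), 2 * c 2 / (1 + ‖c‖ ^ 2),
      (‖c‖ ^ 2 - 1) / (1 + ‖c‖ ^ 2)]

/-- Stereographic projection from the pole `e₊`. At points with last coordinate `1` on the unit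
sphere the value is `0`. -/
def stereo (p : R4) : E3 :=
  WithLp.toLp 2 ![p 0 / (1 - p 3), p 1 / (1 - p 3), p 2 / (1 - p 3)]

lemma sph_infty : sph OnePoint.infty = ![0, 0, 0, 1] := rfl

lemma sph_coe (c : E3) : sph (c : OnePoint E3) =
    ![2 * c 0 / (1 + ‖c‖ ^ 2), 2 * c 1 / (1 + ‖c‖ ^ 2), 2 * c 2 / (1 + ‖c‖ ^ 2),
      (‖c‖ ^ 2 - 1) / (1 + ‖c‖ ^ 2)] := rfl

lemma pt_eq (x : OnePoint E3) : ∃ k : ℝ, k ≠ 0 ∧ pt x = k • vec (sph x) 1 := by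
  induction x using OnePoint.rec with
  | infty => exact ⟨1, one_ne_zero, by simp [pt, vec_eq, sph_infty]⟩
  | coe c =>
    have h : (1 + ‖c‖ ^ 2) ≠ 0 := by positivity
    refine ⟨(1 + ‖c‖ ^ 2) / 2, by positivity, ?_⟩
    simp only [pt, OnePoint.elim_some, sphereVec, vec_eq, sph_coe]
    simp
    match_scalars <;> (field_simp; try ring)

lemma sph_dot_self (x : OnePoint E3) : sph x ⬝ᵥ sph x = 1 := by
  induction x using OnePoint.rec with
  | infty => simp [sph_infty]
  | coe c =>
    have h : (1 + ‖c‖ ^ 2) ≠ 0 := by positivity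
    simp only [dot_eq, sph_coe]
    simp
    field_simp
    linear_combination (-4) * norm_sq_E3 c

lemma sph_three_coe_ne (c : E3) : 1 - sph (c : OnePoint E3) 3 ≠ 0 := by
  have h : 1 + ‖c‖ ^ 2 ≠ 0 := by positivity
  have : 1 - sph (c : OnePoint E3) 3 = 2 / (1 + ‖c‖ ^ 2) := by
    simp only [sph_coe]
    simp
    field_simp
    ring
  rw [this]
  positivity

lemma sph_three_eq_one {x : OnePoint E3} : sph x 3 = 1 ↔ x = OnePoint.infty := by
  induction x using OnePoint.rec with
  | infty => simp [sph_infty]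
  | coe c =>
    simp only [OnePoint.coe_ne_infty, iff_false]
    exact fun h => sph_three_coe_ne c (by rw [h, sub_self])

lemma stereo_sph_coe (c : E3) : stereo (sph (c : OnePoint E3)) = c := by
  have h : 1 + ‖c‖ ^ 2 ≠ 0 := by positivity
  have h3 : 1 - (‖c‖ ^ 2 - 1) / (1 + ‖c‖ ^ 2) = 2 / (1 + ‖c‖ ^ 2) := by
    field_simp
    ring
  ext i
  fin_cases i <;> simp [stereo, sph_coe, h3] <;> field_simp

lemma sph_injective : Function.Injective sph := by
  intro x y h
  induction x using OnePoint.rec with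
  | infty => exact (sph_three_eq_one.mp (by rw [← h, sph_three_eq_one])).symm
  | coe c =>
    induction y using OnePoint.rec with
    | infty => exact sph_three_eq_one.mp (by rw [h, sph_three_eq_one])
    | coe d => rw [← stereo_sph_coe c, ← stereo_sph_coe d, h]

lemma exists_sph {p : R4} (hp : p ⬝ᵥ p = 1) : ∃ x, sph x = p := by
  rw [dot_eq] at hp
  by_cases h3 : p 3 = 1
  · refine ⟨OnePoint.infty, ?_⟩
    have h0 : p 0 = 0 := by nlinarith
    have h1 : p 1 = 0 := by nlinarith
    have h2 : p 2 = 0 := by nlinarith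
    ext i
    fin_cases i <;> simp [sph_infty, h0, h1, h2, h3]
  · have h : 1 - p 3 ≠ 0 := fun h => h3 (by linarith)
    refine ⟨(stereo p : E3), ?_⟩
    have hn : ‖stereo p‖ ^ 2 = 2 / (1 - p 3) - 1 := by
      rw [norm_sq_E3]
      simp [stereo]
      field_simp
      linear_combination hp
    rw [sph_coe, hn]
    ext i
    fin_cases i <;> simp [stereo] <;> field_simp
    ring

lemma represents_smul_vec {k : ℝ} (hk : k ≠ 0) (p : R4) (x : OnePoint E3) :
    Represents (k • vec p 1) x ↔ sph x = p := by
  obtain ⟨l, hl, hx⟩ := pt_eq x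
  constructor
  · rintro ⟨k', hk', h⟩
    rw [hx, smul_smul, smul_vec, smul_vec] at h
    obtain ⟨h1, h2⟩ := vec_injective h
    rw [mul_one, mul_one] at h2
    rw [← h2] at h1
    exact (smul_right_injective R4 hk h1).symm
  · rintro rfl
    exact ⟨k / l, div_ne_zero hk hl, by rw [hx, smul_smul, div_mul_cancel₀ _ hl]⟩

/-- The sandwich map of `b` is, up to a factor, the linear map `T` of `ℝ⁴` and fixes `e₋`. -/
def ActsBy (b : CGA) (T : R4 → R4) : Prop :=
  ∃ k : ℝ, k ≠ 0 ∧ ∀ p z, b * vec p z * rev b = k • vec (T p) z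

lemma ActsBy.mul {a b : CGA} {F G : R4 → R4} (ha : ActsBy a F) (hb : ActsBy b G) :
    ActsBy (a * b) (F ∘ G) := by
  obtain ⟨k, hk, ha⟩ := ha
  obtain ⟨l, hl, hb⟩ := hb
  refine ⟨l * k, mul_ne_zero hl hk, fun p z => ?_⟩
  have : a * b * vec p z * rev (a * b) = a * (b * vec p z * rev b) * rev a := by
    rw [rev_mul]
    simp only [mul_assoc]
  rw [this, hb, mul_smul_comm, smul_mul_assoc, ha, smul_smul]
  rfl

lemma ActsBy.mapsPoint {b : CGA} {T : R4 → R4} (h : ActsBy b T) (x y : OnePoint E3) :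
    MapsPoint b x y ↔ sph y = T (sph x) := by
  obtain ⟨k, hk, h⟩ := h
  obtain ⟨l, hl, hx⟩ := pt_eq x
  rw [MapsPoint, hx, mul_smul_comm, smul_mul_assoc, h, smul_smul]
  exact represents_smul_vec (mul_ne_zero hl hk) _ _

lemma IsRotor.actsBy {B : CGA} {j : R4 → R4} (h : IsRotor B j) (t : OnePoint ℝ) :
    ActsBy (linearMotion B t) (rotate j (cosine t) (sine t)) :=
  ⟨scale t, (scale_pos t).ne', h.linearMotion_sandwich t⟩

/-! ### The trajectories on the three-sphere -/

/-- The orthogonal projection onto the plane of the rotation `h₁ w`. -/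
def proj₁ (w : E3) : R4 →ₗ[ℝ] R4 := (1 / 2 : ℝ) • (LinearMap.id + opU ∘ₗ opW w)

/-- The orthogonal projection onto the plane of the rotation `h₂ w`. -/
def proj₂ (w : E3) : R4 →ₗ[ℝ] R4 := (1 / 2 : ℝ) • (LinearMap.id - opU ∘ₗ opW w)

lemma proj_add (w : E3) (p : R4) : proj₁ w p + proj₂ w p = p := by
  simp only [proj₁, proj₂, LinearMap.smul_apply, LinearMap.add_apply, LinearMap.sub_apply,
    LinearMap.id_apply]
  module

lemma rot₁_rot₁ {w : E3} (hw : ‖w‖ = 1) (p : R4) : rot₁ w (rot₁ w p) = -proj₁ w p := by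
  simp only [rot₁, proj₁, LinearMap.smul_apply, LinearMap.sub_apply, LinearMap.add_apply,
    LinearMap.comp_apply, LinearMap.id_apply, map_smul, map_sub, opU_opU, opW_opW hw, ← opU_opW]
  module

lemma rot₂_rot₂ {w : E3} (hw : ‖w‖ = 1) (p : R4) : rot₂ w (rot₂ w p) = -proj₂ w p := by
  simp only [rot₂, proj₂, LinearMap.smul_apply, LinearMap.sub_apply, LinearMap.add_apply,
    LinearMap.comp_apply, LinearMap.id_apply, map_smul, map_add, opU_opU, opW_opW hw, ← opU_opW]
  module

lemma rot₁_rot₂ {w : E3} (hw : ‖w‖ = 1) (p : R4) : rot₁ w (rot₂ w p) = 0 := by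
  simp only [rot₁, rot₂, LinearMap.smul_apply, LinearMap.sub_apply, LinearMap.add_apply,
    map_smul, map_add, opU_opU, opW_opW hw, ← opU_opW]
  module

lemma rot₁_add_rot₂ (w : E3) (p : R4) : rot₁ w p + rot₂ w p = opU p := by
  simp only [rot₁, rot₂, LinearMap.smul_apply, LinearMap.sub_apply, LinearMap.add_apply]
  module

/-- The torus of points obtained from `p` by independent rotations in the planes of `h₁ w` and
`h₂ w`. -/
def torusMap (w : E3) (p : R4) (s t : OnePoint ℝ) : R4 :=
  (cosine s • proj₁ w p + sine s • rot₁ w p) + (cosine t • proj₂ w p + sine t • rot₂ w p)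

lemma rotate_rotate {w : E3} (hw : ‖w‖ = 1) (p : R4) (c s c' s' : ℝ) :
    rotate (rot₁ w) c s (rotate (rot₂ w) c' s' p) =
      (c • proj₁ w p + s • rot₁ w p) + (c' • proj₂ w p + s' • rot₂ w p) := by
  simp only [rotate, map_add, map_smul, rot₁_rot₂ hw, rot₁_rot₁ hw, smul_zero, add_zero]
  simp only [rot₂_rot₂ hw]
  linear_combination (norm := module) (-1 : ℝ) • proj_add w p

lemma isTrajectorySurface_iff {w : E3} (hw : ‖w‖ = 1) (x : OnePoint E3)
    (D : OnePoint ℝ → OnePoint ℝ → OnePoint E3) :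
    IsTrajectorySurface w x D ↔ ∀ s t, sph (D s t) = torusMap w (sph x) s t := by
  refine forall_congr' fun s => forall_congr' fun t => ?_
  have := (((isRotor_h₁ hw).actsBy s).mul ((isRotor_h₂ hw).actsBy t)).mapsPoint x (D s t)
  rw [MapsPoint, rev_mul, ← mul_assoc, Function.comp_apply, rotate_rotate hw] at this
  exact this

lemma isTrajectory_iff (x : OnePoint E3) (γ : OnePoint ℝ → OnePoint E3) :
    IsTrajectory x γ ↔ ∀ t, sph (γ t) = cosine t • sph x + sine t • opU (sph x) := by
  refine forall_congr' fun t => ?_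
  have := ((isRotor_e01.actsBy t).mul (isRotor_e23.actsBy t)).mapsPoint x (γ t)
  rw [MapsPoint, Function.comp_apply] at this
  rw [C, this]
  suffices h : ∀ (c s : ℝ) (p : R4), rotate (fun p => ![-p 1, p 0, 0, 0]) c s
      (rotate (fun p => ![0, 0, -p 3, p 2]) c s p) = c • p + s • opU p by rw [h]
  intro c s p
  ext i
  fin_cases i <;> simp [rotate, opU, Matrix.vecHead, Matrix.vecTail] <;> ring

/-! ### Circles as intersections of the three-sphere with planes -/

lemma inner_E3 (a b : E3) : ⟪a, b⟫ = a 0 * b 0 + a 1 * b 1 + a 2 * b 2 := by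
  simp [PiLp.inner_apply, Fin.sum_univ_three]
  ring

/-- The hyperplane section `p ⬝ᵥ n = k` of the three-sphere is a Euclidean sphere or plane. -/
lemma sph_coe_dot_eq_iff (c : E3) (n : R4) (k : ℝ) :
    sph (c : OnePoint E3) ⬝ᵥ n = k ↔
      (n 3 - k) * ‖c‖ ^ 2 + 2 * (c 0 * n 0 + c 1 * n 1 + c 2 * n 2) = n 3 + k := by
  have h : 1 + ‖c‖ ^ 2 ≠ 0 := by positivity
  have : sph (c : OnePoint E3) ⬝ᵥ n =
      (2 * (c 0 * n 0 + c 1 * n 1 + c 2 * n 2) + (‖c‖ ^ 2 - 1) * n 3) / (1 + ‖c‖ ^ 2) := by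
    simp only [dot_eq, sph_coe]
    simp
    field_simp
  rw [this, div_eq_iff h]
  constructor <;> intro h <;> linear_combination h

lemma sph_infty_dot (n : R4) : sph OnePoint.infty ⬝ᵥ n = n 3 := by
  rw [dot_eq, sph_infty]
  simp

/-- The hypotheses say that `n₁ + k₁ e₋` and `n₂ + k₂ e₋` are orthonormal for the form `Q`.
If the first of two orthogonal hyperplane sections is a Euclidean plane, then the second one
is either a sphere with centre on this plane, or an orthogonal plane. -/
lemma isCircle_setOf_of_plane {n₁ n₂ : R4} {k₁ k₂ : ℝ} (h₁ : n₁ ⬝ᵥ n₁ = 1 + k₁ ^ 2)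
    (h₂ : n₂ ⬝ᵥ n₂ = 1 + k₂ ^ 2) (h₁₂ : n₁ ⬝ᵥ n₂ = k₁ * k₂) (h₀ : n₁ 3 = k₁) :
    IsCircle {x | sph x ⬝ᵥ n₁ = k₁ ∧ sph x ⬝ᵥ n₂ = k₂} := by
  rw [dot_eq] at h₁ h₂ h₁₂
  have hn : n₁ 0 ^ 2 + n₁ 1 ^ 2 + n₁ 2 ^ 2 = 1 := by rw [h₀] at h₁; linarith
  by_cases hα : n₂ 3 = k₂
  · right
    have hn₂ : n₂ 0 ^ 2 + n₂ 1 ^ 2 + n₂ 2 ^ 2 = 1 := by rw [hα] at h₂; linarith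
    have hn₁₂ : n₁ 0 * n₂ 0 + n₁ 1 * n₂ 1 + n₁ 2 * n₂ 2 = 0 := by
      rw [h₀, hα] at h₁₂; linarith
    have hv : (n₁ 1 * n₂ 2 - n₁ 2 * n₂ 1) ^ 2 + (n₁ 2 * n₂ 0 - n₁ 0 * n₂ 2) ^ 2 +
        (n₁ 0 * n₂ 1 - n₁ 1 * n₂ 0) ^ 2 = 1 := by
      linear_combination (n₂ 0 ^ 2 + n₂ 1 ^ 2 + n₂ 2 ^ 2) * hn + hn₂ -
        (n₁ 0 * n₂ 0 + n₁ 1 * n₂ 1 + n₁ 2 * n₂ 2) * hn₁₂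
    set v0 := n₁ 1 * n₂ 2 - n₁ 2 * n₂ 1 with hv0
    set v1 := n₁ 2 * n₂ 0 - n₁ 0 * n₂ 2 with hv1
    set v2 := n₁ 0 * n₂ 1 - n₁ 1 * n₂ 0 with hv2
    refine ⟨!₂[k₁ * n₁ 0 + k₂ * n₂ 0, k₁ * n₁ 1 + k₂ * n₂ 1, k₁ * n₁ 2 + k₂ * n₂ 2],
      !₂[v0, v1, v2], fun h => ?_, ?_⟩
    · have e0 := congrArg (fun u : E3 => u 0) h
      have e1 := congrArg (fun u : E3 => u 1) h
      have e2 := congrArg (fun u : E3 => u 2) h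
      simp at e0 e1 e2
      rw [e0, e1, e2] at hv
      norm_num at hv
    · ext x
      induction x using OnePoint.rec with
      | infty => simp [sph_infty_dot, h₀, hα]
      | coe c =>
        simp only [Set.mem_ofPred_eq, sph_coe_dot_eq_iff, h₀, hα, Set.mem_insert_iff,
          OnePoint.coe_ne_infty, false_or, Set.mem_image, OnePoint.coe_eq_coe, exists_eq_right,
          Set.mem_range]
        constructor
        · rintro ⟨a, b⟩
          have a' : c 0 * n₁ 0 + c 1 * n₁ 1 + c 2 * n₁ 2 = k₁ := by linarith
          have b' : c 0 * n₂ 0 + c 1 * n₂ 1 + c 2 * n₂ 2 = k₂ := by linarith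
          set d0 := c 0 - (k₁ * n₁ 0 + k₂ * n₂ 0) with hd0
          set d1 := c 1 - (k₁ * n₁ 1 + k₂ * n₂ 1) with hd1
          set d2 := c 2 - (k₁ * n₁ 2 + k₂ * n₂ 2) with hd2
          have E1 : d0 * n₁ 0 + d1 * n₁ 1 + d2 * n₁ 2 = 0 := by
            linear_combination a' - k₁ * hn - k₂ * hn₁₂
          have E2 : d0 * n₂ 0 + d1 * n₂ 1 + d2 * n₂ 2 = 0 := by
            linear_combination b' - k₂ * hn₂ - k₁ * hn₁₂
          have X0 : v1 * d2 - v2 * d1 = 0 := by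
            linear_combination n₂ 0 * E1 - n₁ 0 * E2
          have X1 : v2 * d0 - v0 * d2 = 0 := by
            linear_combination n₂ 1 * E1 - n₁ 1 * E2
          have X2 : v0 * d1 - v1 * d0 = 0 := by
            linear_combination n₂ 2 * E1 - n₁ 2 * E2
          refine ⟨d0 * v0 + d1 * v1 + d2 * v2, ?_⟩
          ext i
          fin_cases i <;> simp
          · linear_combination v1 * X2 - v2 * X1 + d0 * hv
          · linear_combination v2 * X0 - v0 * X2 + d1 * hv
          · linear_combination v0 * X1 - v1 * X0 + d2 * hv
        · rintro ⟨a, rfl⟩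
          simp
          constructor
          · linear_combination 2 * k₁ * hn + 2 * k₂ * hn₁₂
          · linear_combination 2 * k₂ * hn₂ + 2 * k₁ * hn₁₂
  · left
    have hα' : n₂ 3 - k₂ ≠ 0 := sub_ne_zero.mpr hα
    refine ⟨{c | dist c (!₂[-n₂ 0 / (n₂ 3 - k₂), -n₂ 1 / (n₂ 3 - k₂), -n₂ 2 / (n₂ 3 - k₂)] : E3) =
        |1 / (n₂ 3 - k₂)| ∧ ⟪c - !₂[-n₂ 0 / (n₂ 3 - k₂), -n₂ 1 / (n₂ 3 - k₂),
          -n₂ 2 / (n₂ 3 - k₂)], (!₂[n₁ 0, n₁ 1, n₁ 2] : E3)⟫ = 0},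
      ⟨_, _, _, ?_, by positivity, rfl⟩, ?_⟩
    · rw [← sq_eq_sq₀ (norm_nonneg _) zero_le_one, norm_sq_E3]
      simpa using hn
    · ext x
      induction x using OnePoint.rec with
      | infty => simp [sph_infty_dot, hα]
      | coe c =>
        simp only [Set.mem_ofPred_eq, sph_coe_dot_eq_iff, Set.mem_image, OnePoint.coe_eq_coe,
          exists_eq_right]
        rw [dist_eq_norm, ← sq_eq_sq₀ (norm_nonneg _) (abs_nonneg _), sq_abs, norm_sq_E3,
          norm_sq_E3, inner_E3]
        simp
        rw [and_comm, h₀, sub_self, zero_mul, zero_add]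
        rw [h₀] at h₁₂
        refine and_congr ?_ ?_
        · field_simp
          constructor <;> intro h
          · linear_combination (n₂ 3 - k₂) * h + h₂
          · refine mul_left_cancel₀ hα' ?_
            linear_combination h - h₂
        · field_simp
          constructor <;> intro h
          · linear_combination (n₂ 3 - k₂) / 2 * h + h₁₂
          · refine mul_left_cancel₀ hα' ?_
            linear_combination 2 * h - 2 * h₁₂

/-- Two orthogonal hyperplane sections of the three-sphere that meet in real points intersect in
a circle: in the pencil they span there is a Euclidean plane. -/
lemma isCircle_setOf {n₁ n₂ : R4} {k₁ k₂ : ℝ} (h₁ : n₁ ⬝ᵥ n₁ = 1 + k₁ ^ 2)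
    (h₂ : n₂ ⬝ᵥ n₂ = 1 + k₂ ^ 2) (h₁₂ : n₁ ⬝ᵥ n₂ = k₁ * k₂) :
    IsCircle {x | sph x ⬝ᵥ n₁ = k₁ ∧ sph x ⬝ᵥ n₂ = k₂} := by
  -- rotate the pair so that the first section passes through the pole `e₊`
  obtain ⟨c, s, hcs, h0⟩ : ∃ c s : ℝ, c ^ 2 + s ^ 2 = 1 ∧
      c * (n₁ 3 - k₁) + s * (n₂ 3 - k₂) = 0 := by
    set a := n₁ 3 - k₁
    set b := n₂ 3 - k₂
    rcases eq_or_ne (a ^ 2 + b ^ 2) 0 with h | h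
    · exact ⟨1, 0, by norm_num, by nlinarith⟩
    · have hr : Real.sqrt (a ^ 2 + b ^ 2) ^ 2 = a ^ 2 + b ^ 2 := Real.sq_sqrt (by positivity)
      have hr0 : Real.sqrt (a ^ 2 + b ^ 2) ≠ 0 := by
        intro h0; rw [h0] at hr; exact h (by linarith)
      refine ⟨b / Real.sqrt (a ^ 2 + b ^ 2), -a / Real.sqrt (a ^ 2 + b ^ 2), ?_, ?_⟩
      · field_simp
        linarith
      · field_simp
        ring
  have key := isCircle_setOf_of_plane (n₁ := c • n₁ + s • n₂) (n₂ := c • n₂ - s • n₁)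
    (k₁ := c * k₁ + s * k₂) (k₂ := c * k₂ - s * k₁)
    (by
      simp only [add_dotProduct, dotProduct_add, smul_dotProduct, dotProduct_smul, smul_eq_mul,
        h₁, h₂, dotProduct_comm n₂ n₁, h₁₂]
      linear_combination hcs)
    (by
      simp only [sub_dotProduct, dotProduct_sub, smul_dotProduct, dotProduct_smul, smul_eq_mul,
        h₁, h₂, dotProduct_comm n₂ n₁, h₁₂]
      linear_combination hcs)
    (by
      simp only [add_dotProduct, dotProduct_sub, smul_dotProduct, dotProduct_smul, smul_eq_mul,
        h₁, h₂, dotProduct_comm n₂ n₁, h₁₂]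
      ring)
    (by simp; linear_combination h0)
  convert key using 1
  ext x
  simp only [Set.mem_ofPred_eq, dotProduct_add, dotProduct_sub, dotProduct_smul, smul_eq_mul]
  constructor
  · rintro ⟨a, b⟩
    rw [a, b]
    exact ⟨rfl, rfl⟩
  · rintro ⟨a, b⟩
    constructor
    · linear_combination c * a - s * b - (sph x ⬝ᵥ n₁ - k₁) * hcs
    · linear_combination s * a + c * b - (sph x ⬝ᵥ n₂ - k₂) * hcs

/-- In terms of `ℝ⁴`: the section of the three-sphere by a two-plane that meets its interior is a
circle. -/
lemma isCircle_setOf_of_orthogonal {n₁ n₂ : R4} {k N : ℝ} (h₁ : n₁ ⬝ᵥ n₁ = N)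
    (h₂ : n₂ ⬝ᵥ n₂ = N) (h₁₂ : n₁ ⬝ᵥ n₂ = 0) (hN : 0 < N) (hk : k ^ 2 < N) :
    IsCircle {x | sph x ⬝ᵥ n₁ = k ∧ sph x ⬝ᵥ n₂ = 0} := by
  have hr : Real.sqrt (N - k ^ 2) ^ 2 = N - k ^ 2 := Real.sq_sqrt (by linarith)
  have hr0 : Real.sqrt (N - k ^ 2) ≠ 0 := (Real.sqrt_pos.mpr (by linarith)).ne'
  have hq : Real.sqrt N ^ 2 = N := Real.sq_sqrt hN.le
  have hq0 : Real.sqrt N ≠ 0 := (Real.sqrt_pos.mpr hN).ne'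
  set r := Real.sqrt (N - k ^ 2)
  set q := Real.sqrt N
  have key := isCircle_setOf (n₁ := r⁻¹ • n₁) (n₂ := q⁻¹ • n₂) (k₁ := r⁻¹ * k) (k₂ := 0)
    (by
      simp only [smul_dotProduct, dotProduct_smul, smul_eq_mul, h₁]
      field_simp
      linarith)
    (by
      simp only [smul_dotProduct, dotProduct_smul, smul_eq_mul, h₂]
      field_simp
      linarith)
    (by simp [h₁₂])
  convert key using 1
  ext x
  simp only [Set.mem_ofPred_eq, dotProduct_smul, smul_eq_mul]
  rw [mul_right_inj' (inv_ne_zero hr0), mul_eq_zero, or_iff_right (inv_ne_zero hq0)]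

/-! ### The two rotation planes and the Hopf fibration -/

lemma opU_dot_opU (p q : R4) : opU p ⬝ᵥ opU q = p ⬝ᵥ q := by
  simp only [dot_eq]
  simp [opU]
  ring

lemma dot_opU_self (p : R4) : p ⬝ᵥ opU p = 0 := by
  simp only [dot_eq]
  simp [opU]
  ring

lemma opW_dot_opW {w : E3} (hw : ‖w‖ = 1) (p q : R4) : opW w p ⬝ᵥ opW w q = p ⬝ᵥ q := by
  have h := norm_sq_E3 w
  rw [hw] at h
  simp only [dot_eq]
  simp [opW]
  linear_combination (-(p 0 * q 0 + p 1 * q 1 + p 2 * q 2 + p 3 * q 3)) * h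

lemma rot₁_eq_opU (w : E3) (p : R4) : rot₁ w p = opU (proj₁ w p) := by
  simp only [rot₁, proj₁, LinearMap.smul_apply, LinearMap.sub_apply, LinearMap.add_apply,
    LinearMap.comp_apply, LinearMap.id_apply, map_smul, map_add, opU_opU]
  module

lemma rot₂_eq_opU (w : E3) (p : R4) : rot₂ w p = opU (proj₂ w p) := by
  simp only [rot₂, proj₂, LinearMap.smul_apply, LinearMap.sub_apply, LinearMap.add_apply,
    LinearMap.comp_apply, LinearMap.id_apply, map_smul, map_sub, opU_opU]
  module

/-- Membership in the plane of the rotation `h₁ w` (for `ε = -1`) or `h₂ w` (for `ε = 1`). -/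
def InPlane (w : E3) (ε : ℝ) (p : R4) : Prop := opW w p = ε • opU p

lemma inPlane_proj₁ {w : E3} (hw : ‖w‖ = 1) (p : R4) : InPlane w (-1) (proj₁ w p) := by
  simp only [InPlane, proj₁, LinearMap.smul_apply, LinearMap.add_apply, LinearMap.comp_apply,
    LinearMap.id_apply, map_smul, map_add, opU_opU, ← opU_opW, opW_opW hw, map_neg]
  module

lemma inPlane_proj₂ {w : E3} (hw : ‖w‖ = 1) (p : R4) : InPlane w 1 (proj₂ w p) := by
  simp only [InPlane, proj₂, LinearMap.smul_apply, LinearMap.sub_apply, LinearMap.comp_apply,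
    LinearMap.id_apply, map_smul, map_sub, opU_opU, ← opU_opW, opW_opW hw, map_neg]
  module

lemma InPlane.map_opU {w : E3} {ε : ℝ} {p : R4} (h : InPlane w ε p) : InPlane w ε (opU p) := by
  rw [InPlane, ← opU_opW, h, map_smul]

lemma InPlane.add {w : E3} {ε : ℝ} {p q : R4} (hp : InPlane w ε p) (hq : InPlane w ε q) :
    InPlane w ε (p + q) := by
  rw [InPlane, map_add, map_add, hp, hq, smul_add]

lemma InPlane.smul {w : E3} {ε : ℝ} {p : R4} (h : InPlane w ε p) (k : ℝ) :
    InPlane w ε (k • p) := by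
  rw [InPlane, map_smul, map_smul, h, smul_comm]

lemma InPlane.dot_eq_zero {w : E3} (hw : ‖w‖ = 1) {ε : ℝ} (hε : ε * ε = 1) {p q : R4}
    (hp : InPlane w ε p) (hq : InPlane w (-ε) q) : p ⬝ᵥ q = 0 := by
  have := opW_dot_opW hw p q
  rw [hp, hq, smul_dotProduct, dotProduct_smul, opU_dot_opU] at this
  simp only [smul_eq_mul] at this
  linear_combination (-1 / 2) * this - (p ⬝ᵥ q) / 2 * hε

lemma exists_inPlane_add {w : E3} (hw : ‖w‖ = 1) {ε : ℝ} (hε : ε * ε = 1) (q : R4) :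
    ∃ u v, InPlane w ε u ∧ InPlane w (-ε) v ∧ u + v = q := by
  rcases mul_self_eq_one_iff.mp hε with rfl | rfl
  · exact ⟨_, _, inPlane_proj₂ hw q, inPlane_proj₁ hw q, by rw [add_comm, proj_add]⟩
  · exact ⟨_, _, inPlane_proj₁ hw q, by simpa using inPlane_proj₂ hw q, proj_add w q⟩

lemma InPlane.opU_opW_eq {w : E3} {ε : ℝ} {p : R4} (h : InPlane w ε p) :
    opU (opW w p) = -ε • p := by
  rw [h, map_smul, opU_opU]
  module

lemma proj₁_add {w : E3} {p q : R4} (hp : InPlane w (-1) p) (hq : InPlane w 1 q) :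
    proj₁ w (p + q) = p := by
  simp only [proj₁, LinearMap.smul_apply, LinearMap.add_apply, LinearMap.comp_apply,
    LinearMap.id_apply, map_add, hp.opU_opW_eq, hq.opU_opW_eq]
  module

lemma proj₂_add {w : E3} {p q : R4} (hp : InPlane w (-1) p) (hq : InPlane w 1 q) :
    proj₂ w (p + q) = q := by
  simp only [proj₂, LinearMap.smul_apply, LinearMap.sub_apply, LinearMap.comp_apply,
    LinearMap.id_apply, map_add, hp.opU_opW_eq, hq.opU_opW_eq]
  module

/-- A left multiplication by an imaginary unit orthogonal to that of `opU`. -/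
def opK (p : R4) : R4 := ![-p 2, p 3, p 0, -p 1]

/-- For a unit vector `y` the vectors `y, U y, K y, U K y` form an orthonormal frame. -/
lemma quaternion_frame (p y : R4) :
    (y ⬝ᵥ y) • p = (p ⬝ᵥ y) • y + (p ⬝ᵥ opU y) • opU y + (p ⬝ᵥ opK y) • opK y +
      (p ⬝ᵥ opU (opK y)) • opU (opK y) := by
  ext i
  simp only [Pi.add_apply, Pi.smul_apply, smul_eq_mul, dot_eq]
  fin_cases i <;> simp [opU, opK] <;> ring

/-- The set `InPlane w ε` is at most two-dimensional: the orthogonal frame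
`y, U y, K y, U K y` of `ℝ⁴` has two vectors inside and two vectors orthogonal to it. -/
lemma InPlane.expand {w : E3} (hw : ‖w‖ = 1) {ε : ℝ} (hε : ε * ε = 1) {p y : R4}
    (hp : InPlane w ε p) (hy : InPlane w ε y) :
    (y ⬝ᵥ y) • p = (p ⬝ᵥ y) • y + (p ⬝ᵥ opU y) • opU y := by
  have hK : ∀ q, opW w (opK q) = opK (opW w q) := fun q => by
    ext i; fin_cases i <;> simp [opW, opK] <;> ring
  have hUK : ∀ q, opK (opU q) = -opU (opK q) := fun q => by
    ext i; fin_cases i <;> simp [opU, opK]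
  have hKs : ∀ (k : ℝ) q, opK (k • q) = k • opK q := fun k q => by
    ext i; fin_cases i <;> simp [opK]
  have h1 : p ⬝ᵥ opK y = 0 := by
    have := opW_dot_opW hw p (opK y)
    rw [hK, hp, hy, hKs, hUK, smul_dotProduct, dotProduct_smul, dotProduct_neg, opU_dot_opU]
      at this
    simp only [smul_eq_mul] at this
    linear_combination (-1 / 2) * this - (p ⬝ᵥ opK y) / 2 * hε
  have h2 : p ⬝ᵥ opU (opK y) = 0 := by
    have := opW_dot_opW hw p (opU (opK y))
    rw [← opU_opW, hK, hp, hy, hKs, hUK, map_smul, smul_dotProduct, dotProduct_smul,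
      opU_dot_opU, dotProduct_neg] at this
    simp only [smul_eq_mul] at this
    linear_combination (-1 / 2) * this - (p ⬝ᵥ opU (opK y)) / 2 * hε
  rw [quaternion_frame p y, h1, h2]
  simp

/-- The Hopf map of the fibration of the three-sphere by the trajectories of the Villarceau
motion. -/
def hopf (p : R4) : E3 :=
  !₂[-2 * (p 0 * p 2 + p 1 * p 3), 2 * (p 0 * p 3 - p 1 * p 2),
    p 0 ^ 2 + p 1 ^ 2 - p 2 ^ 2 - p 3 ^ 2]

lemma proj₁_dot_self {w : E3} (hw : ‖w‖ = 1) (p : R4) :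
    proj₁ w p ⬝ᵥ proj₁ w p = (p ⬝ᵥ p + ⟪hopf p, w⟫) / 2 := by
  have h : p ⬝ᵥ opU (opW w p) = ⟪hopf p, w⟫ := by
    simp only [dot_eq, inner_E3]
    simp [opU, opW, hopf]
    ring
  simp only [proj₁, LinearMap.smul_apply, LinearMap.add_apply, LinearMap.comp_apply,
    LinearMap.id_apply, smul_dotProduct, dotProduct_smul, add_dotProduct, dotProduct_add, h,
    dotProduct_comm _ p, opU_dot_opU, opW_dot_opW hw, smul_eq_mul]
  ring

lemma proj₂_dot_self {w : E3} (hw : ‖w‖ = 1) (p : R4) :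
    proj₂ w p ⬝ᵥ proj₂ w p = (p ⬝ᵥ p - ⟪hopf p, w⟫) / 2 := by
  have h : p ⬝ᵥ opU (opW w p) = ⟪hopf p, w⟫ := by
    simp only [dot_eq, inner_E3]
    simp [opU, opW, hopf]
    ring
  simp only [proj₂, LinearMap.smul_apply, LinearMap.sub_apply, LinearMap.comp_apply,
    LinearMap.id_apply, smul_dotProduct, dotProduct_smul, sub_dotProduct, dotProduct_sub, h,
    dotProduct_comm _ p, opU_dot_opU, opW_dot_opW hw, smul_eq_mul]
  ring

lemma norm_hopf {p : R4} (hp : p ⬝ᵥ p = 1) : ‖hopf p‖ = 1 := by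
  rw [← sq_eq_sq₀ (norm_nonneg _) zero_le_one, norm_sq_E3]
  rw [dot_eq] at hp
  simp [hopf]
  linear_combination (p 0 * p 0 + p 1 * p 1 + p 2 * p 2 + p 3 * p 3 + 1) * hp

lemma exists_hopf_eq {v : E3} (hv : ‖v‖ = 1) : ∃ p : R4, p ⬝ᵥ p = 1 ∧ hopf p = v := by
  have h := norm_sq_E3 v
  rw [hv] at h
  by_cases h2 : v 2 = -1
  · have h0 : v 0 = 0 := by nlinarith
    have h1 : v 1 = 0 := by nlinarith
    refine ⟨![0, 0, 1, 0], by simp, ?_⟩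
    ext i; fin_cases i <;> simp [hopf, h0, h1, h2]
  · have hpos : 0 < (1 + v 2) / 2 := by
      have : -1 ≤ v 2 := by nlinarith [sq_nonneg (v 0), sq_nonneg (v 1)]
      have : -1 < v 2 := lt_of_le_of_ne this (Ne.symm h2)
      linarith
    have hr : Real.sqrt ((1 + v 2) / 2) ^ 2 = (1 + v 2) / 2 := Real.sq_sqrt hpos.le
    have hr0 : Real.sqrt ((1 + v 2) / 2) ≠ 0 := (Real.sqrt_pos.mpr hpos).ne'
    set r := Real.sqrt ((1 + v 2) / 2)
    have e : 4 * r ^ 2 * (v 2 - 1) + 2 * (v 0 ^ 2 + v 1 ^ 2) = 0 := by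
      linear_combination 4 * (v 2 - 1) * hr - 2 * h
    -- the point of the Hopf fibre with second coordinate `0`
    refine ⟨![r, 0, -v 0 / (2 * r), v 1 / (2 * r)], ?_, ?_⟩
    · simp
      field_simp
      linear_combination 4 * r ^ 2 * hr + e / 2
    · ext i; fin_cases i <;> simp [hopf] <;> field_simp
      linear_combination 4 * r ^ 2 * hr - e / 2

/-! ### The trajectory surfaces and their parameter lines -/

lemma torusMap_eq (w : E3) (p : R4) (s t : OnePoint ℝ) :
    torusMap w p s t = (cosine s • proj₁ w p + sine s • opU (proj₁ w p)) +
      (cosine t • proj₂ w p + sine t • opU (proj₂ w p)) := by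
  rw [torusMap, rot₁_eq_opU, rot₂_eq_opU]

lemma circle_dot_self (c s : ℝ) (p : R4) :
    (c • p + s • opU p) ⬝ᵥ (c • p + s • opU p) = (c ^ 2 + s ^ 2) * (p ⬝ᵥ p) := by
  simp only [add_dotProduct, dotProduct_add, smul_dotProduct, dotProduct_smul, smul_eq_mul,
    opU_dot_opU, dot_opU_self, dotProduct_comm (opU p) p]
  ring

lemma InPlane.circle {w : E3} {ε : ℝ} {p : R4} (h : InPlane w ε p) (c s : ℝ) :
    InPlane w ε (c • p + s • opU p) := (h.smul c).add (h.map_opU.smul s)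

/-- Two non-zero vectors of equal length in one plane differ by a rotation. -/
lemma InPlane.exists_cosine_sine {w : E3} (hw : ‖w‖ = 1) {ε : ℝ} (hε : ε * ε = 1) {p y : R4}
    (hp : InPlane w ε p) (hy : InPlane w ε y) (hpy : p ⬝ᵥ p = y ⬝ᵥ y) (h0 : y ≠ 0) :
    ∃ t, cosine t • y + sine t • opU y = p := by
  have hN : y ⬝ᵥ y ≠ 0 := fun h => h0 (dot_self_eq_zero.mp h)
  have hex := hp.expand hw hε hy
  have hp' : (p ⬝ᵥ y / (y ⬝ᵥ y)) • y + (p ⬝ᵥ opU y / (y ⬝ᵥ y)) • opU y = p := by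
    refine smul_right_injective R4 hN ?_
    simp only [hex, smul_add, smul_smul]
    congr 2 <;> field_simp
  obtain ⟨t, h1, h2⟩ := Villarceau.exists_cosine_sine
    (c := p ⬝ᵥ y / (y ⬝ᵥ y)) (s := p ⬝ᵥ opU y / (y ⬝ᵥ y)) (by
      have := circle_dot_self (p ⬝ᵥ y / (y ⬝ᵥ y)) (p ⬝ᵥ opU y / (y ⬝ᵥ y)) y
      rw [hp', hpy] at this
      exact mul_right_cancel₀ hN (by linarith))
  exact ⟨t, by rw [h1, h2, hp']⟩

lemma hopf_torusMap {w : E3} (hw : ‖w‖ = 1) (p : R4) (s t : OnePoint ℝ) :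
    torusMap w p s t ⬝ᵥ torusMap w p s t = p ⬝ᵥ p ∧
      ⟪hopf (torusMap w p s t), w⟫ = ⟪hopf p, w⟫ := by
  have h1 := proj₁_dot_self hw (torusMap w p s t)
  have h2 := proj₂_dot_self hw (torusMap w p s t)
  have ha := (inPlane_proj₁ hw p).circle (cosine s) (sine s)
  have hb := (inPlane_proj₂ hw p).circle (cosine t) (sine t)
  rw [torusMap_eq] at h1 h2 ⊢
  rw [proj₁_add ha hb, circle_dot_self, cosine_sq_add_sine_sq, proj₁_dot_self hw] at h1
  rw [proj₂_add ha hb, circle_dot_self, cosine_sq_add_sine_sq, proj₂_dot_self hw] at h2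
  constructor <;> linarith

lemma exists_torusMap_eq {w : E3} (hw : ‖w‖ = 1) {p q : R4} (h₁ : proj₁ w p ≠ 0)
    (h₂ : proj₂ w p ≠ 0) (hq : q ⬝ᵥ q = p ⬝ᵥ p) (h : ⟪hopf q, w⟫ = ⟪hopf p, w⟫) :
    ∃ s t, torusMap w p s t = q := by
  obtain ⟨s, hs⟩ := (inPlane_proj₁ hw q).exists_cosine_sine hw (by norm_num)
    (inPlane_proj₁ hw p) (by rw [proj₁_dot_self hw, proj₁_dot_self hw, hq, h]) h₁
  obtain ⟨t, ht⟩ := (inPlane_proj₂ hw q).exists_cosine_sine hw (by norm_num)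
    (inPlane_proj₂ hw p) (by rw [proj₂_dot_self hw, proj₂_dot_self hw, hq, h]) h₂
  exact ⟨s, t, by rw [torusMap_eq, hs, ht, proj_add]⟩

lemma carrier_subset {w : E3} (hw : ‖w‖ = 1) {x : OnePoint E3}
    {D : OnePoint ℝ → OnePoint ℝ → OnePoint E3}
    (hD : ∀ s t, sph (D s t) = torusMap w (sph x) s t) :
    carrier D ⊆ {y | ⟪hopf (sph y), w⟫ = ⟪hopf (sph x), w⟫} := by
  rintro _ ⟨⟨s, t⟩, rfl⟩
  change ⟪hopf (sph (D s t)), w⟫ = _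
  rw [hD]
  exact (hopf_torusMap hw _ s t).2

lemma carrier_eq {w : E3} (hw : ‖w‖ = 1) {x : OnePoint E3}
    {D : OnePoint ℝ → OnePoint ℝ → OnePoint E3}
    (hD : ∀ s t, sph (D s t) = torusMap w (sph x) s t) (h₁ : proj₁ w (sph x) ≠ 0)
    (h₂ : proj₂ w (sph x) ≠ 0) :
    carrier D = {y | ⟪hopf (sph y), w⟫ = ⟪hopf (sph x), w⟫} := by
  refine (carrier_subset hw hD).antisymm fun y hy => ?_
  obtain ⟨s, t, h⟩ := exists_torusMap_eq hw h₁ h₂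
    (by rw [sph_dot_self, sph_dot_self]) (Set.mem_ofPred_eq ▸ hy)
  exact ⟨⟨s, t⟩, sph_injective (by rw [hD, h])⟩

lemma proj₁_ne_zero {w : E3} (hw : ‖w‖ = 1) {x : OnePoint E3}
    (h : ¬ IsFixedPoint (h₁ w) x) : proj₁ w (sph x) ≠ 0 := fun h0 => h fun t => by
  rw [((isRotor_h₁ hw).actsBy t).mapsPoint]
  simp [rotate, rot₁_eq_opU, h0]

lemma proj₂_ne_zero {w : E3} (hw : ‖w‖ = 1) {x : OnePoint E3}
    (h : ¬ IsFixedPoint (h₂ w) x) : proj₂ w (sph x) ≠ 0 := fun h0 => h fun t => by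
  rw [((isRotor_h₂ hw).actsBy t).mapsPoint]
  simp [rotate, rot₂_eq_opU, h0]

lemma abs_inner_hopf_lt {w : E3} (hw : ‖w‖ = 1) {p : R4} (hp : p ⬝ᵥ p = 1)
    (h₁ : proj₁ w p ≠ 0) (h₂ : proj₂ w p ≠ 0) : |⟪hopf p, w⟫| < 1 := by
  have e1 := proj₁_dot_self hw p
  have e2 := proj₂_dot_self hw p
  have p1 : 0 < proj₁ w p ⬝ᵥ proj₁ w p :=
    lt_of_le_of_ne (dotProduct_self_star_nonneg (proj₁ w p))
      fun h => h₁ (dot_self_eq_zero.mp h.symm)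
  have p2 : 0 < proj₂ w p ⬝ᵥ proj₂ w p :=
    lt_of_le_of_ne (dotProduct_self_star_nonneg (proj₂ w p))
      fun h => h₂ (dot_self_eq_zero.mp h.symm)
  rw [abs_lt]
  constructor <;> linarith

/-- The set `a + {b rotated}` on the three-sphere, for vectors `a` and `b` in orthogonal planes,
is a circle. -/
lemma isCircle_range_add {w : E3} (hw : ‖w‖ = 1) {ε : ℝ} (hε : ε * ε = 1) {a b : R4}
    (ha : InPlane w ε a) (hb : InPlane w (-ε) b) (h1 : a ⬝ᵥ a + b ⬝ᵥ b = 1) (ha0 : a ≠ 0)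
    (hb0 : b ≠ 0) {f : OnePoint ℝ → OnePoint E3}
    (hf : ∀ t, sph (f t) = a + (cosine t • b + sine t • opU b)) :
    IsCircle (Set.range f) := by
  have hN : a ⬝ᵥ a ≠ 0 := fun h => ha0 (dot_self_eq_zero.mp h)
  have hNb : b ⬝ᵥ b ≠ 0 := fun h => hb0 (dot_self_eq_zero.mp h)
  have hN' : 0 < a ⬝ᵥ a := lt_of_le_of_ne (dotProduct_self_star_nonneg a) hN.symm
  have hNb' : 0 < b ⬝ᵥ b := lt_of_le_of_ne (dotProduct_self_star_nonneg b) hNb.symm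
  -- the two-plane is `a` plus the plane of `b`, on which `a` and `opU a` are constant
  have key := isCircle_setOf_of_orthogonal (n₁ := a) (n₂ := opU a) (k := a ⬝ᵥ a) rfl
    (opU_dot_opU a a) (dot_opU_self a) hN' (by nlinarith)
  convert key using 1
  ext y
  constructor
  · rintro ⟨t, rfl⟩
    have hbt := hb.circle (cosine t) (sine t)
    refine ⟨?_, ?_⟩
    · rw [hf, add_dotProduct, dotProduct_comm (cosine t • b + sine t • opU b),
        ha.dot_eq_zero hw hε hbt, add_zero]
    · rw [hf, add_dotProduct, dotProduct_comm (cosine t • b + sine t • opU b),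
        ha.map_opU.dot_eq_zero hw hε hbt, add_zero, dot_opU_self]
  · rintro ⟨e1, e2⟩
    obtain ⟨u, v, hu, hv, huv⟩ := exists_inPlane_add hw hε (sph y)
    rw [← huv, add_dotProduct, dotProduct_comm v, ha.dot_eq_zero hw hε hv, add_zero] at e1
    rw [← huv, add_dotProduct, dotProduct_comm v, ha.map_opU.dot_eq_zero hw hε hv, add_zero] at e2
    have hua : u = a := by
      have := hu.expand hw hε ha
      rw [e1, e2, zero_smul, add_zero] at this
      exact smul_right_injective R4 hN this
    subst hua
    have hvv : v ⬝ᵥ v = b ⬝ᵥ b := by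
      have := sph_dot_self y
      rw [← huv, add_dotProduct, dotProduct_add, dotProduct_add, dotProduct_comm v u,
        hu.dot_eq_zero hw hε hv] at this
      linarith
    obtain ⟨t, ht⟩ := hv.exists_cosine_sine hw (by linarith) hb hvv hb0
    exact ⟨t, sph_injective (by rw [hf, ht, huv])⟩

lemma proj_dot_add {w : E3} (hw : ‖w‖ = 1) (p : R4) :
    proj₁ w p ⬝ᵥ proj₁ w p + proj₂ w p ⬝ᵥ proj₂ w p = p ⬝ᵥ p := by
  rw [proj₁_dot_self hw, proj₂_dot_self hw]
  ring

lemma circle_ne_zero {p : R4} (hp : p ≠ 0) (t : OnePoint ℝ) :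
    cosine t • p + sine t • opU p ≠ 0 := fun h => hp (by
  have := circle_dot_self (cosine t) (sine t) p
  rw [h, cosine_sq_add_sine_sq, one_mul, zero_dotProduct] at this
  exact dot_self_eq_zero.mp this.symm)

lemma isCircle_range_right {w : E3} (hw : ‖w‖ = 1) {x : OnePoint E3}
    {D : OnePoint ℝ → OnePoint ℝ → OnePoint E3}
    (hD : ∀ s t, sph (D s t) = torusMap w (sph x) s t) (h₁ : proj₁ w (sph x) ≠ 0)
    (h₂ : proj₂ w (sph x) ≠ 0) (s : OnePoint ℝ) : IsCircle (Set.range fun t => D s t) := by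
  refine isCircle_range_add hw (ε := -1) (by norm_num)
    ((inPlane_proj₁ hw (sph x)).circle (cosine s) (sine s))
    (b := proj₂ w (sph x)) (by simpa using inPlane_proj₂ hw (sph x)) ?_ (circle_ne_zero h₁ s) h₂
    fun t => by rw [hD, torusMap_eq]
  rw [circle_dot_self, cosine_sq_add_sine_sq, one_mul, proj_dot_add hw, sph_dot_self]

lemma isCircle_range_left {w : E3} (hw : ‖w‖ = 1) {x : OnePoint E3}
    {D : OnePoint ℝ → OnePoint ℝ → OnePoint E3}
    (hD : ∀ s t, sph (D s t) = torusMap w (sph x) s t) (h₁ : proj₁ w (sph x) ≠ 0)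
    (h₂ : proj₂ w (sph x) ≠ 0) (t : OnePoint ℝ) : IsCircle (Set.range fun s => D s t) := by
  refine isCircle_range_add hw (ε := 1) (by norm_num)
    ((inPlane_proj₂ hw (sph x)).circle (cosine t) (sine t))
    (b := proj₁ w (sph x)) (inPlane_proj₁ hw (sph x)) ?_ (circle_ne_zero h₂ t) h₁
    fun s => by rw [hD, torusMap_eq, add_comm]
  rw [circle_dot_self, cosine_sq_add_sine_sq, one_mul, add_comm, proj_dot_add hw, sph_dot_self]

/-- The trajectories of the Villarceau motion are great circles of the three-sphere. -/
lemma range_trajectory_eq {x : OnePoint E3} {γ : OnePoint ℝ → OnePoint E3}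
    (hγ : ∀ t, sph (γ t) = cosine t • sph x + sine t • opU (sph x)) :
    Set.range γ = {y | sph y ⬝ᵥ opK (sph x) = 0 ∧ sph y ⬝ᵥ opU (opK (sph x)) = 0} := by
  have hx := sph_dot_self x
  have hUK : ∀ q : R4, q ⬝ᵥ opK q = 0 ∧ q ⬝ᵥ opU (opK q) = 0 ∧ opU q ⬝ᵥ opK q = 0 ∧
      opU q ⬝ᵥ opU (opK q) = 0 := fun q => by
    simp only [dot_eq]
    refine ⟨?_, ?_, ?_, ?_⟩ <;> simp [opU, opK] <;> ring
  obtain ⟨k1, k2, k3, k4⟩ := hUK (sph x)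
  ext y
  constructor
  · rintro ⟨t, rfl⟩
    constructor
    all_goals
      simp only [hγ, add_dotProduct, smul_dotProduct, k1, k2, k3, k4]
      simp
  · rintro ⟨e1, e2⟩
    have h3 := quaternion_frame (sph y) (sph x)
    rw [e1, e2, hx, one_smul, zero_smul, zero_smul, add_zero, add_zero] at h3
    have h4 := circle_dot_self (sph y ⬝ᵥ sph x) (sph y ⬝ᵥ opU (sph x)) (sph x)
    rw [← h3, sph_dot_self, hx, mul_one] at h4
    obtain ⟨t, h5, h6⟩ := exists_cosine_sine h4.symm
    exact ⟨t, sph_injective (by rw [hγ, h5, h6, ← h3])⟩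

lemma isCircle_range_trajectory {x : OnePoint E3} {γ : OnePoint ℝ → OnePoint E3}
    (hγ : ∀ t, sph (γ t) = cosine t • sph x + sine t • opU (sph x)) :
    IsCircle (Set.range γ) := by
  rw [range_trajectory_eq hγ]
  have h : ∀ q : R4, opK q ⬝ᵥ opK q = q ⬝ᵥ q := fun q => by
    simp only [dot_eq]
    simp [opK]
    ring
  refine isCircle_setOf_of_orthogonal (N := 1) ?_ ?_ (dot_opU_self _) one_pos (by norm_num)
  · rw [h, sph_dot_self]
  · rw [opU_dot_opU, h, sph_dot_self]

/-- The circle of latitude `{v | ⟪v, w⟫ = k}` on the unit sphere, of positive radius,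
determines its axis up to sign. -/
lemma axis_unique {w w' : E3} (hw : ‖w‖ = 1) (hw' : ‖w'‖ = 1) {k k' : ℝ} (hk : |k| < 1)
    (h : ∀ v : E3, ‖v‖ = 1 → ⟪v, w⟫ = k → ⟪v, w'⟫ = k') : w' = w ∨ w' = -w := by
  set a := w' - ⟪w', w⟫ • w with ha
  have hww : ⟪w, w⟫ = 1 := by rw [real_inner_self_eq_norm_sq, hw, one_pow]
  have haw : ⟪a, w⟫ = 0 := by rw [ha, inner_sub_left, real_inner_smul_left, hww]; ring
  have haw' : ⟪w, a⟫ = 0 := by rw [real_inner_comm, haw]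
  have ha0 : a = 0 := by
    by_contra hne
    have hna : ‖a‖ ≠ 0 := norm_ne_zero_iff.mpr hne
    have hr : 0 < 1 - k ^ 2 := by nlinarith [abs_lt.mp hk]
    have hr2 := Real.sq_sqrt hr.le
    have hr0 := Real.sqrt_pos.mpr hr
    set r := Real.sqrt (1 - k ^ 2)
    -- the diameter of the circle of latitude in the direction of `a` is not orthogonal to `w'`
    have hv : ∀ ρ : ℝ, ρ ^ 2 = r ^ 2 → ⟪k • w + (ρ / ‖a‖) • a, w'⟫ = k' := fun ρ hρ => by
      refine h _ ?_ ?_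
      · rw [← sq_eq_sq₀ (norm_nonneg _) zero_le_one, ← real_inner_self_eq_norm_sq]
        simp only [inner_add_left, inner_add_right, real_inner_smul_left, real_inner_smul_right,
          haw, haw', hww, real_inner_self_eq_norm_sq a]
        field_simp
        linear_combination ‖a‖ * (hρ + hr2)
      · simp only [inner_add_left, real_inner_smul_left, haw, hww]
        ring
    have e1 := hv r rfl
    have e2 := hv (-r) (by ring)
    have haa : ⟪a, w'⟫ = ‖a‖ ^ 2 := by
      rw [← real_inner_self_eq_norm_sq]
      conv_rhs => rw [ha, ← ha, inner_sub_right, real_inner_smul_right, haw]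
      ring
    simp only [inner_add_left, real_inner_smul_left, haa] at e1 e2
    have e3 : r / ‖a‖ * ‖a‖ ^ 2 = 0 := by
      rw [neg_div] at e2
      linarith
    rcases mul_eq_zero.mp e3 with h | h
    · exact (div_ne_zero hr0.ne' hna) h
    · exact hna (by simpa using h)
  have hw'' : w' = ⟪w', w⟫ • w := sub_eq_zero.mp ha0
  have hn : |⟪w', w⟫| = 1 := by
    have := congrArg norm hw''
    rw [norm_smul, hw, hw', mul_one] at this
    exact this.symm
  rcases (abs_eq zero_le_one).mp hn with h | h <;> rw [h] at hw''
  · left; simpa using hw''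
  · right; simpa using hw''

/-- The surface `D'` may be degenerate, in which case it is only contained in the preimage of a
circle of latitude; the inclusion suffices. -/
lemma axis_unique_of_carrier_eq {w w' : E3} (hw : ‖w‖ = 1) (hw' : ‖w'‖ = 1) {x : OnePoint E3}
    {D D' : OnePoint ℝ → OnePoint ℝ → OnePoint E3}
    (hD : ∀ s t, sph (D s t) = torusMap w (sph x) s t)
    (hD' : ∀ s t, sph (D' s t) = torusMap w' (sph x) s t) (h₁ : proj₁ w (sph x) ≠ 0)
    (h₂ : proj₂ w (sph x) ≠ 0) (h : carrier D' = carrier D) : w' = w ∨ w' = -w := by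
  refine axis_unique hw hw' (k := ⟪hopf (sph x), w⟫) (k' := ⟪hopf (sph x), w'⟫)
    (abs_inner_hopf_lt hw (sph_dot_self x) h₁ h₂) fun v hv hvw => ?_
  obtain ⟨p, hp, rfl⟩ := exists_hopf_eq hv
  obtain ⟨y, rfl⟩ := exists_sph hp
  have hy : y ∈ carrier D' := by
    rw [h, carrier_eq hw hD h₁ h₂]
    exact hvw
  exact carrier_subset hw' hD' hy

/-! ### Fundamental forms of stereographic images of translation surfaces -/

lemma partialDeriv_zero_eq {f : ℝ × ℝ → E3} {p : ℝ × ℝ} {v : E3} (hf : DifferentiableAt ℝ f p)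
    (h : HasDerivAt (fun s => f (s, p.2)) v p.1) : partialDeriv 0 f p = v := by
  have h1 : HasDerivAt (fun s : ℝ => (s, p.2)) ((1, 0) : ℝ × ℝ) p.1 :=
    (hasDerivAt_id p.1).prodMk (hasDerivAt_const _ _)
  have h2 : HasFDerivAt f (fderiv ℝ f p) ((fun s : ℝ => (s, p.2)) p.1) := hf.hasFDerivAt
  exact (h2.comp_hasDerivAt p.1 h1).unique h

lemma partialDeriv_one_eq {f : ℝ × ℝ → E3} {p : ℝ × ℝ} {v : E3} (hf : DifferentiableAt ℝ f p)
    (h : HasDerivAt (fun t => f (p.1, t)) v p.2) : partialDeriv 1 f p = v := by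
  have h1 : HasDerivAt (fun t : ℝ => (p.1, t)) ((0, 1) : ℝ × ℝ) p.2 :=
    (hasDerivAt_const _ _).prodMk (hasDerivAt_id p.2)
  have h2 : HasFDerivAt f (fderiv ℝ f p) ((fun t : ℝ => (p.1, t)) p.2) := hf.hasFDerivAt
  exact (h2.comp_hasDerivAt p.2 h1).unique h

lemma inner_partialDeriv_unitNormal (f : ℝ × ℝ → E3) (p : ℝ × ℝ) (i : Fin 2) :
    ⟪partialDeriv i f p, unitNormal f p⟫ = 0 := by
  rw [unitNormal, real_inner_smul_right]
  refine mul_eq_zero_of_right _ ?_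
  rw [inner_E3]
  fin_cases i <;> simp [cross_apply] <;> ring

lemma differentiableAt_partialDeriv {f : ℝ × ℝ → E3} {p : ℝ × ℝ} (hf : ContDiffAt ℝ ∞ f p)
    (i : Fin 2) : DifferentiableAt ℝ (partialDeriv i f) p :=
  ((hf.fderiv_right (m := 1) (by norm_cast)).differentiableAt (by norm_num)).clm_apply
    (differentiableAt_const _)

/-- The stereographic image of the translation surface `(A s, α s) + (B t, β t)` of `ℝ⁴`. -/
def stereoSum (A B : ℝ → E3) (α β : ℝ → ℝ) (p : ℝ × ℝ) : E3 :=
  (1 - α p.1 - β p.2)⁻¹ • (A p.1 + B p.2)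

section

variable {A B A' B' : ℝ → E3} {α β α' β' : ℝ → ℝ}

lemma contDiffAt_stereoSum (hA : ContDiff ℝ ∞ A) (hB : ContDiff ℝ ∞ B) (hα : ContDiff ℝ ∞ α)
    (hβ : ContDiff ℝ ∞ β) {p : ℝ × ℝ} (hp : 1 - α p.1 - β p.2 ≠ 0) :
    ContDiffAt ℝ ∞ (stereoSum A B α β) p := by
  have h1 : ContDiff ℝ ∞ fun p : ℝ × ℝ => 1 - α p.1 - β p.2 :=
    (contDiff_const.sub (hα.comp contDiff_fst)).sub (hβ.comp contDiff_snd)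
  have h2 : ContDiff ℝ ∞ fun p : ℝ × ℝ => A p.1 + B p.2 :=
    (hA.comp contDiff_fst).add (hB.comp contDiff_snd)
  exact (h1.contDiffAt.inv hp).smul h2.contDiffAt

lemma hasDerivAt_stereoSum_left (hA : ∀ s, HasDerivAt A (A' s) s)
    (hα : ∀ s, HasDerivAt α (α' s) s) {s t : ℝ} (hp : 1 - α s - β t ≠ 0) :
    HasDerivAt (fun s => stereoSum A B α β (s, t))
      ((1 - α s - β t)⁻¹ • (A' s + α' s • stereoSum A B α β (s, t))) s := by
  have h := ((((hα s).const_sub 1).sub_const (β t)).inv hp).smul ((hA s).add_const (B t))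
  refine h.congr_deriv ?_
  simp only [stereoSum, Pi.inv_apply]
  match_scalars <;> field_simp

lemma stereoSum_swap (s t : ℝ) : stereoSum A B α β (s, t) = stereoSum B A β α (t, s) := by
  simp only [stereoSum]
  rw [add_comm, sub_right_comm]

lemma hasDerivAt_stereoSum_right (hB : ∀ s, HasDerivAt B (B' s) s)
    (hβ : ∀ s, HasDerivAt β (β' s) s) {s t : ℝ} (hp : 1 - α s - β t ≠ 0) :
    HasDerivAt (fun t => stereoSum A B α β (s, t))
      ((1 - α s - β t)⁻¹ • (B' t + β' t • stereoSum A B α β (s, t))) t := by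
  rw [sub_right_comm] at hp ⊢
  simp only [stereoSum_swap (A := A) (B := B)]
  exact hasDerivAt_stereoSum_left hB hβ hp

lemma partialDeriv_zero_stereoSum (cA : ContDiff ℝ ∞ A) (cB : ContDiff ℝ ∞ B)
    (cα : ContDiff ℝ ∞ α) (cβ : ContDiff ℝ ∞ β) (hA : ∀ s, HasDerivAt A (A' s) s)
    (hα : ∀ s, HasDerivAt α (α' s) s) {s t : ℝ} (hp : 1 - α s - β t ≠ 0) :
    partialDeriv 0 (stereoSum A B α β) (s, t) =
      (1 - α s - β t)⁻¹ • (A' s + α' s • stereoSum A B α β (s, t)) :=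
  partialDeriv_zero_eq
    ((contDiffAt_stereoSum cA cB cα cβ (p := (s, t)) hp).differentiableAt (by simp))
    (hasDerivAt_stereoSum_left hA hα hp)

lemma partialDeriv_one_stereoSum (cA : ContDiff ℝ ∞ A) (cB : ContDiff ℝ ∞ B)
    (cα : ContDiff ℝ ∞ α) (cβ : ContDiff ℝ ∞ β) (hB : ∀ s, HasDerivAt B (B' s) s)
    (hβ : ∀ s, HasDerivAt β (β' s) s) {s t : ℝ} (hp : 1 - α s - β t ≠ 0) :
    partialDeriv 1 (stereoSum A B α β) (s, t) =
      (1 - α s - β t)⁻¹ • (B' t + β' t • stereoSum A B α β (s, t)) :=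
  partialDeriv_one_eq
    ((contDiffAt_stereoSum cA cB cα cβ (p := (s, t)) hp).differentiableAt (by simp))
    (hasDerivAt_stereoSum_right hB hβ hp)

/-- The mixed derivative of `(A s, α s) + (B t, β t)` vanishes. Therefore the mixed derivative of
its stereographic image is tangential. -/
lemma partialDeriv_one_zero_stereoSum (cA : ContDiff ℝ ∞ A) (cB : ContDiff ℝ ∞ B)
    (cα : ContDiff ℝ ∞ α) (cβ : ContDiff ℝ ∞ β) (hA : ∀ s, HasDerivAt A (A' s) s)
    (hα : ∀ s, HasDerivAt α (α' s) s) (hB : ∀ s, HasDerivAt B (B' s) s)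
    (hβ : ∀ s, HasDerivAt β (β' s) s) {s t : ℝ} (hp : 1 - α s - β t ≠ 0) :
    partialDeriv 1 (partialDeriv 0 (stereoSum A B α β)) (s, t) =
      (β' t / (1 - α s - β t)) • partialDeriv 0 (stereoSum A B α β) (s, t) +
        (α' s / (1 - α s - β t)) • partialDeriv 1 (stereoSum A B α β) (s, t) := by
  refine partialDeriv_one_eq
    (differentiableAt_partialDeriv (contDiffAt_stereoSum cA cB cα cβ (p := (s, t)) hp) 0) ?_
  have hev : (fun t => partialDeriv 0 (stereoSum A B α β) (s, t)) =ᶠ[nhds t]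
      fun t => (1 - α s - β t)⁻¹ • (A' s + α' s • stereoSum A B α β (s, t)) := by
    have hc : ContinuousAt (fun t => 1 - α s - β t) t :=
      (continuous_const.sub cβ.continuous).continuousAt
    filter_upwards [hc.eventually_ne hp] with t ht
    exact partialDeriv_zero_stereoSum cA cB cα cβ hA hα ht
  refine HasDerivAt.congr_of_eventuallyEq ?_ hev
  have h := (((hβ t).const_sub (1 - α s)).inv hp).smul
    (((hasDerivAt_stereoSum_right (A := A) (α := α) hB hβ hp).const_smul (α' s)).const_add (A' s))
  refine h.congr_deriv ?_
  rw [partialDeriv_zero_stereoSum cA cB cα cβ hA hα hp,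
    partialDeriv_one_stereoSum cA cB cα cβ hB hβ hp]
  simp only [Pi.inv_apply, Pi.smul_apply]
  match_scalars <;> field_simp

lemma partialDeriv_zero_one_stereoSum (cA : ContDiff ℝ ∞ A) (cB : ContDiff ℝ ∞ B)
    (cα : ContDiff ℝ ∞ α) (cβ : ContDiff ℝ ∞ β) (hA : ∀ s, HasDerivAt A (A' s) s)
    (hα : ∀ s, HasDerivAt α (α' s) s) (hB : ∀ s, HasDerivAt B (B' s) s)
    (hβ : ∀ s, HasDerivAt β (β' s) s) {s t : ℝ} (hp : 1 - α s - β t ≠ 0) :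
    partialDeriv 0 (partialDeriv 1 (stereoSum A B α β)) (s, t) =
      (β' t / (1 - α s - β t)) • partialDeriv 0 (stereoSum A B α β) (s, t) +
        (α' s / (1 - α s - β t)) • partialDeriv 1 (stereoSum A B α β) (s, t) := by
  refine partialDeriv_zero_eq
    (differentiableAt_partialDeriv (contDiffAt_stereoSum cA cB cα cβ (p := (s, t)) hp) 1) ?_
  have hev : (fun s => partialDeriv 1 (stereoSum A B α β) (s, t)) =ᶠ[nhds s]
      fun s => (1 - α s - β t)⁻¹ • (B' t + β' t • stereoSum A B α β (s, t)) := by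
    have hc : ContinuousAt (fun s => 1 - α s - β t) s :=
      ((continuous_const.sub cα.continuous).sub continuous_const).continuousAt
    filter_upwards [hc.eventually_ne hp] with s hs
    exact partialDeriv_one_stereoSum cA cB cα cβ hB hβ hs
  refine HasDerivAt.congr_of_eventuallyEq ?_ hev
  have h := ((((hα s).const_sub 1).sub_const (β t)).inv hp).smul
    (((hasDerivAt_stereoSum_left (B := B) (β := β) hA hα hp).const_smul (β' t)).const_add (B' t))
  refine h.congr_deriv ?_
  rw [partialDeriv_zero_stereoSum cA cB cα cβ hA hα hp,
    partialDeriv_one_stereoSum cA cB cα cβ hB hβ hp]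
  simp only [Pi.inv_apply, Pi.smul_apply]
  match_scalars <;> field_simp

/-- Stereographic projection is conformal: inner products of tangent vectors of the unit sphere
get multiplied by a common factor. -/
lemma stereo_conformal {X u v : E3} {h a b : ℝ} (hX : ‖X‖ ^ 2 + h ^ 2 = 1)
    (hu : ⟪u, X⟫ + a * h = 0) (hv : ⟪v, X⟫ + b * h = 0) (hh : 1 - h ≠ 0) :
    ⟪(1 - h)⁻¹ • (u + a • (1 - h)⁻¹ • X), (1 - h)⁻¹ • (v + b • (1 - h)⁻¹ • X)⟫ =
      (⟪u, v⟫ + a * b) / (1 - h) ^ 2 := by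
  simp only [real_inner_smul_left, real_inner_smul_right, inner_add_left, inner_add_right,
    real_inner_self_eq_norm_sq, real_inner_comm v X]
  rw [eq_neg_of_add_eq_zero_left hu, eq_neg_of_add_eq_zero_left hv,
    eq_sub_of_add_eq hX]
  field_simp
  ring

/-- For a translation surface on the unit sphere with orthogonal, non-vanishing velocities, the
stereographic image is a regular surface whose parameter lines are lines of curvature. -/
lemma stereoSum_regular (cA : ContDiff ℝ ∞ A) (cB : ContDiff ℝ ∞ B)
    (cα : ContDiff ℝ ∞ α) (cβ : ContDiff ℝ ∞ β) (hA : ∀ s, HasDerivAt A (A' s) s)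
    (hα : ∀ s, HasDerivAt α (α' s) s) (hB : ∀ s, HasDerivAt B (B' s) s)
    (hβ : ∀ s, HasDerivAt β (β' s) s) {s t : ℝ} (hp : 1 - α s - β t ≠ 0)
    (h1 : ‖A s + B t‖ ^ 2 + (α s + β t) ^ 2 = 1)
    (hA2 : ⟪A' s, A s + B t⟫ + α' s * (α s + β t) = 0)
    (hB2 : ⟪B' t, A s + B t⟫ + β' t * (α s + β t) = 0)
    (hAB : ⟪A' s, B' t⟫ + α' s * β' t = 0) (hA0 : ⟪A' s, A' s⟫ + α' s * α' s ≠ 0)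
    (hB0 : ⟪B' t, B' t⟫ + β' t * β' t ≠ 0) :
    ContDiffAt ℝ ∞ (stereoSum A B α β) (s, t) ∧
      LinearIndependent ℝ ![partialDeriv 0 (stereoSum A B α β) (s, t),
        partialDeriv 1 (stereoSum A B α β) (s, t)] ∧
      (firstForm (stereoSum A B α β) (s, t)).IsDiag ∧
      (secondForm (stereoSum A B α β) (s, t)).IsDiag := by
  have hg : 1 - (α s + β t) ≠ 0 := by rwa [← sub_sub]
  have e0 : partialDeriv 0 (stereoSum A B α β) (s, t) = (1 - (α s + β t))⁻¹ •
      (A' s + α' s • (1 - (α s + β t))⁻¹ • (A s + B t)) := by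
    rw [partialDeriv_zero_stereoSum cA cB cα cβ hA hα hp, stereoSum, sub_sub]
  have e1 : partialDeriv 1 (stereoSum A B α β) (s, t) = (1 - (α s + β t))⁻¹ •
      (B' t + β' t • (1 - (α s + β t))⁻¹ • (A s + B t)) := by
    rw [partialDeriv_one_stereoSum cA cB cα cβ hB hβ hp, stereoSum, sub_sub]
  have i01 : ⟪partialDeriv 0 (stereoSum A B α β) (s, t),
      partialDeriv 1 (stereoSum A B α β) (s, t)⟫ = 0 := by
    rw [e0, e1, stereo_conformal h1 hA2 hB2 hg, hAB, zero_div]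
  have n0 : partialDeriv 0 (stereoSum A B α β) (s, t) ≠ 0 := fun h => by
    have := stereo_conformal h1 hA2 hA2 hg
    rw [← e0, h, inner_zero_left] at this
    exact div_ne_zero hA0 (pow_ne_zero 2 hg) this.symm
  have n1 : partialDeriv 1 (stereoSum A B α β) (s, t) ≠ 0 := fun h => by
    have := stereo_conformal h1 hB2 hB2 hg
    rw [← e1, h, inner_zero_left] at this
    exact div_ne_zero hB0 (pow_ne_zero 2 hg) this.symm
  refine ⟨contDiffAt_stereoSum cA cB cα cβ (p := (s, t)) hp, ?_, ?_, ?_⟩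
  · refine linearIndependent_of_ne_zero_of_inner_eq_zero ?_ ?_
    · intro i; fin_cases i
      · exact n0
      · exact n1
    · intro i j hij
      fin_cases i <;> fin_cases j
      · exact absurd rfl hij
      · exact i01
      · exact (real_inner_comm _ _).trans i01
      · exact absurd rfl hij
  · intro i j hij
    fin_cases i <;> fin_cases j
    · exact absurd rfl hij
    · exact i01
    · exact (real_inner_comm _ _).trans i01
    · exact absurd rfl hij
  · intro i j hij
    have hn := inner_partialDeriv_unitNormal (stereoSum A B α β) (s, t)
    fin_cases i <;> fin_cases j
    · exact absurd rfl hij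
    · change ⟪partialDeriv 0 (partialDeriv 1 _) _, _⟫ = 0
      rw [partialDeriv_zero_one_stereoSum cA cB cα cβ hA hα hB hβ hp, inner_add_left,
        real_inner_smul_left, real_inner_smul_left, hn, hn, mul_zero, mul_zero, add_zero]
    · change ⟪partialDeriv 1 (partialDeriv 0 _) _, _⟫ = 0
      rw [partialDeriv_one_zero_stereoSum cA cB cα cβ hA hα hB hβ hp, inner_add_left,
        real_inner_smul_left, real_inner_smul_left, hn, hn, mul_zero, mul_zero, add_zero]
    · exact absurd rfl hij

end

/-! ### Regularity of the trajectory surfaces -/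

lemma contDiff_circle {E : Type*} [NormedAddCommGroup E] [NormedSpace ℝ E] (u v : E) :
    ContDiff ℝ ∞ fun s : ℝ => cosine s • u + sine s • v := by
  simp only [cosine, sine, OnePoint.elim_some]
  have h : ∀ s : ℝ, s ^ 2 + 1 ≠ 0 := fun s => by positivity
  exact (((by fun_prop : ContDiff ℝ ∞ fun s : ℝ => s ^ 2 - 1).div (by fun_prop) h).smul
    contDiff_const).add (((by fun_prop : ContDiff ℝ ∞ fun s : ℝ => 2 * s).div
      (by fun_prop) h).smul contDiff_const)

lemma hasDerivAt_circle {E : Type*} [NormedAddCommGroup E] [NormedSpace ℝ E] (u v : E) (s : ℝ) :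
    HasDerivAt (fun s : ℝ => cosine s • u + sine s • v)
      ((2 / (s ^ 2 + 1)) • (sine s • u - cosine s • v)) s := by
  simp only [cosine, sine, OnePoint.elim_some]
  have h : s ^ 2 + 1 ≠ 0 := by positivity
  have h2 : HasDerivAt (fun s : ℝ => s ^ 2) (2 * s) s := by simpa using hasDerivAt_pow 2 s
  have hc := ((h2.sub_const 1).div (h2.add_const 1) h).smul_const u
  have hs := (((hasDerivAt_id s).const_mul 2).div (h2.add_const 1) h).smul_const v
  refine (hc.add hs).congr_deriv ?_
  simp only [id]
  match_scalars <;> (field_simp; ring)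

/-- The projection of `ℝ⁴` to `ℝ³` along `e₊`. -/
def dropLast (p : R4) : E3 := !₂[p 0, p 1, p 2]

lemma inner_dropLast (p q : R4) : ⟪dropLast p, dropLast q⟫ + p 3 * q 3 = p ⬝ᵥ q := by
  rw [inner_E3, dot_eq]
  simp [dropLast]

lemma euclideanChart_eq {w : E3} {p : R4} {D : OnePoint ℝ → OnePoint ℝ → OnePoint E3}
    (hD : ∀ s t, sph (D s t) = torusMap w p s t) :
    euclideanChart D = stereoSum
      (fun s => cosine s • dropLast (proj₁ w p) + sine s • dropLast (opU (proj₁ w p)))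
      (fun t => cosine t • dropLast (proj₂ w p) + sine t • dropLast (opU (proj₂ w p)))
      (fun s => cosine s • proj₁ w p 3 + sine s • opU (proj₁ w p) 3)
      (fun t => cosine t • proj₂ w p 3 + sine t • opU (proj₂ w p) 3) := by
  have key : ∀ y : OnePoint E3, y.elim 0 id = stereo (sph y) := fun y => by
    induction y using OnePoint.rec with
    | infty =>
      ext i
      fin_cases i <;> simp [stereo, sph_infty]
    | coe c => rw [stereo_sph_coe]; rfl
  ext q i
  rw [euclideanChart, key, hD, torusMap_eq]
  fin_cases i <;> simp [stereo, stereoSum, dropLast, div_eq_inv_mul, sub_sub] <;> ring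

lemma trajectorySurface_regular {w : E3} (hw : ‖w‖ = 1) {x : OnePoint E3}
    {D : OnePoint ℝ → OnePoint ℝ → OnePoint E3}
    (hD : ∀ s t, sph (D s t) = torusMap w (sph x) s t) (h₁ : proj₁ w (sph x) ≠ 0)
    (h₂ : proj₂ w (sph x) ≠ 0) {s t : ℝ}
    (hst : D (s : OnePoint ℝ) (t : OnePoint ℝ) ≠ OnePoint.infty) :
    ContDiffAt ℝ ∞ (euclideanChart D) (s, t) ∧
      LinearIndependent ℝ ![partialDeriv 0 (euclideanChart D) (s, t),
        partialDeriv 1 (euclideanChart D) (s, t)] ∧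
      (firstForm (euclideanChart D) (s, t)).IsDiag ∧
      (secondForm (euclideanChart D) (s, t)).IsDiag := by
  have hP := inPlane_proj₁ hw (sph x)
  have hR := inPlane_proj₂ hw (sph x)
  have hg : 1 - torusMap w (sph x) s t 3 ≠ 0 := fun h => hst (sph_three_eq_one.mp (by
    rw [hD]; linarith))
  have hone := (hopf_torusMap hw (sph x) s t).1
  rw [sph_dot_self] at hone
  rw [torusMap_eq] at hg hone
  rw [euclideanChart_eq hD]
  set u := proj₁ w (sph x)
  set v := proj₂ w (sph x)
  have hN : u ⬝ᵥ u ≠ 0 := fun h => h₁ (dot_self_eq_zero.mp h)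
  have hM : v ⬝ᵥ v ≠ 0 := fun h => h₂ (dot_self_eq_zero.mp h)
  -- the velocity of a circle is a multiple of a rotated copy of that circle
  have vel : ∀ (c s k : ℝ) (p : R4),
      k • (s • dropLast p - c • dropLast (opU p)) = dropLast (k • (s • p + (-c) • opU p)) ∧
      k • (s • p 3 - c • opU p 3) = (k • (s • p + (-c) • opU p)) 3 := fun c s k p => by
    constructor
    · ext i; fin_cases i <;> simp [dropLast, mul_sub] <;> ring
    · simp [sub_eq_add_neg]
  have pos : ∀ (c s c' s' : ℝ) (p q : R4),
      (c • dropLast p + s • dropLast (opU p)) + (c' • dropLast q + s' • dropLast (opU q)) =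
        dropLast ((c • p + s • opU p) + (c' • q + s' • opU q)) ∧
      (c • p 3 + s • opU p 3) + (c' • q 3 + s' • opU q 3) =
        ((c • p + s • opU p) + (c' • q + s' • opU q)) 3 := fun c s c' s' p q => by
    constructor
    · ext i; fin_cases i <;> simp [dropLast]
    · simp
  have orth : ∀ (c s c' s' : ℝ), (c • u + s • opU u) ⬝ᵥ (c' • v + s' • opU v) = 0 :=
    fun c s c' s' =>
      (hP.circle c s).dot_eq_zero hw (by norm_num) (by simpa using hR.circle c' s')
  have orth' : ∀ (c s c' s' : ℝ), (c • v + s • opU v) ⬝ᵥ (c' • u + s' • opU u) = 0 :=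
    fun c s c' s' => (dotProduct_comm _ _).trans (orth c' s' c s)
  have skew : ∀ (c s : ℝ) (p : R4), (s • p + (-c) • opU p) ⬝ᵥ (c • p + s • opU p) = 0 :=
    fun c s p => by
      simp only [add_dotProduct, dotProduct_add, smul_dotProduct, dotProduct_smul, smul_eq_mul,
        opU_dot_opU, dot_opU_self, dotProduct_comm (opU p) p]
      ring
  refine stereoSum_regular (contDiff_circle _ _) (contDiff_circle _ _) (contDiff_circle _ _)
    (contDiff_circle _ _) (hasDerivAt_circle _ _) (hasDerivAt_circle _ _) (hasDerivAt_circle _ _)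
    (hasDerivAt_circle _ _) ?_ ?_ ?_ ?_ ?_ ?_ ?_
  · rw [sub_sub, (pos _ _ _ _ _ _).2]
    exact hg
  · rw [(pos _ _ _ _ _ _).1, (pos _ _ _ _ _ _).2, ← real_inner_self_eq_norm_sq, sq,
      inner_dropLast, hone]
  · rw [(pos _ _ _ _ _ _).1, (pos _ _ _ _ _ _).2, (vel _ _ _ _).1, (vel _ _ _ _).2,
      inner_dropLast, smul_dotProduct, dotProduct_add, skew, orth, add_zero, smul_zero]
  · rw [(pos _ _ _ _ _ _).1, (pos _ _ _ _ _ _).2, (vel _ _ _ _).1, (vel _ _ _ _).2,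
      inner_dropLast, smul_dotProduct, dotProduct_add, skew, orth', add_zero, smul_zero]
  · rw [(vel _ _ _ _).1, (vel _ _ _ _).2, (vel _ _ _ _).1, (vel _ _ _ _).2,
      inner_dropLast, smul_dotProduct, dotProduct_smul, orth, smul_zero, smul_zero]
  · rw [(vel _ _ _ _).1, (vel _ _ _ _).2, inner_dropLast, smul_dotProduct, dotProduct_smul,
      circle_dot_self, neg_sq,
      add_comm (sine (s : OnePoint ℝ) ^ 2), cosine_sq_add_sine_sq, one_mul]
    exact mul_ne_zero (by positivity) (mul_ne_zero (by positivity) hN)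
  · rw [(vel _ _ _ _).1, (vel _ _ _ _).2, inner_dropLast, smul_dotProduct, dotProduct_smul,
      circle_dot_self, neg_sq,
      add_comm (sine (t : OnePoint ℝ) ^ 2), cosine_sq_add_sine_sq, one_mul]
    exact mul_ne_zero (by positivity) (mul_ne_zero (by positivity) hM)

/-! ### Conformal displacements that rotate the Hopf sphere -/

/-- These mirrors are the planes through the origin, the unit sphere, and the spheres that intersect
the unit sphere in a great circle. -/
lemma isMirror_vec {n : R4} (hn : n ≠ 0) : IsMirror (vec n 0) := by
  by_cases h3 : n 3 = 0
  · have hpos : 0 < n 0 ^ 2 + n 1 ^ 2 + n 2 ^ 2 := by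
      refine lt_of_le_of_ne (by positivity) fun h => hn ?_
      refine dot_self_eq_zero.mp ?_
      rw [dot_eq, h3]
      linarith
    have hr : Real.sqrt (n 0 ^ 2 + n 1 ^ 2 + n 2 ^ 2) ^ 2 = n 0 ^ 2 + n 1 ^ 2 + n 2 ^ 2 :=
      Real.sq_sqrt hpos.le
    have hr0 := (Real.sqrt_pos.mpr hpos).ne'
    set r := Real.sqrt (n 0 ^ 2 + n 1 ^ 2 + n 2 ^ 2)
    refine ⟨r, hr0, Or.inr ⟨!₂[n 0 / r, n 1 / r, n 2 / r], 0, ?_, ?_⟩⟩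
    · rw [← sq_eq_sq₀ (norm_nonneg _) zero_le_one, norm_sq_E3]
      simp
      field_simp
      linarith
    · rw [vec_eq, planeVec, h3]
      simp
      match_scalars <;> field_simp
  · set c : E3 := !₂[-n 0 / n 3, -n 1 / n 3, -n 2 / n 3] with hc
    refine ⟨-n 3, neg_ne_zero.mpr h3, Or.inl ⟨c, Real.sqrt (1 + ‖c‖ ^ 2),
      Real.sqrt_pos.mpr (by positivity), ?_⟩⟩
    rw [vec_eq, sphereVec, Real.sq_sqrt (by positivity), hc]
    simp
    match_scalars <;> field_simp

lemma IsConformalDisplacement.mul {a b : CGA} (ha : IsConformalDisplacement a)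
    (hb : IsConformalDisplacement b) : IsConformalDisplacement (a * b) := by
  obtain ⟨k, hk, hk', rfl⟩ := ha
  obtain ⟨l, hl, hl', rfl⟩ := hb
  refine ⟨k ++ l, by rw [List.length_append]; exact hk.add hl, fun c hc => ?_,
    List.prod_append.symm⟩
  rcases List.mem_append.mp hc with h | h
  · exact hk' c h
  · exact hl' c h

lemma e_castSucc (i : Fin 4) : e i.castSucc = vec (Pi.single i 1) 0 := by
  fin_cases i <;> simp [vec_eq]

/-- The factorization is `t - eᵢ eₖ = eᵢ (t eᵢ - eₖ)`. -/
lemma isConformalDisplacement_linearMotion {i k : Fin 4} (hik : i ≠ k) (t : OnePoint ℝ) :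
    IsConformalDisplacement (linearMotion (e i.castSucc * e k.castSucc) t) := by
  induction t using OnePoint.rec with
  | infty => exact ⟨[], by simp, by simp, by simp [linearMotion]⟩
  | coe t =>
    refine ⟨[e i.castSucc, t • e i.castSucc - e k.castSucc], by simp, ?_, ?_⟩
    · intro a ha
      rcases List.mem_pair.mp ha with rfl | rfl
      · rw [e_castSucc]
        exact isMirror_vec (by simp)
      · rw [e_castSucc, e_castSucc, smul_vec, vec_sub, mul_zero, sub_zero]
        refine isMirror_vec fun h => ?_
        have := congrFun h k
        simp [hik] at this
    · have h4 : i.castSucc ≠ 4 := Fin.castSucc_ne_last i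
      simp only [List.prod_cons, List.prod_nil, mul_one, mul_sub, mul_smul_comm, e_mul_self' h4,
        linearMotion, OnePoint.elim_some, Algebra.algebraMap_eq_smul_one]

/-- A right multiplication by a unit quaternion. -/
def rightRot (v : E3) (c s : ℝ) : R4 →ₗ[ℝ] R4 := c • LinearMap.id + s • opW v

lemma rightRot_apply (v : E3) (c s : ℝ) (p : R4) : rightRot v c s p = c • p + s • opW v p := rfl

lemma rightRot_dot_self {v : E3} (hv : ‖v‖ = 1) {c s : ℝ} (h : c ^ 2 + s ^ 2 = 1) (p : R4) :
    rightRot v c s p ⬝ᵥ rightRot v c s p = p ⬝ᵥ p := by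
  have h0 : p ⬝ᵥ opW v p = 0 := by
    simp only [dot_eq]
    simp [opW]
    ring
  simp only [rightRot_apply, add_dotProduct, dotProduct_add, smul_dotProduct, dotProduct_smul,
    smul_eq_mul, opW_dot_opW hv, h0, dotProduct_comm (opW v p) p]
  linear_combination (p ⬝ᵥ p) * h

lemma rightRot_opU (v : E3) (c s : ℝ) (p : R4) :
    rightRot v c s (opU p) = opU (rightRot v c s p) := by
  simp only [rightRot_apply, map_add, map_smul, opU_opW]

lemma rightRot_surjective {v : E3} (hv : ‖v‖ = 1) {c s : ℝ} (h : c ^ 2 + s ^ 2 = 1) :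
    Function.Surjective (rightRot v c s) := fun q => ⟨c • q - s • opW v q, by
  simp only [rightRot_apply, map_sub, map_smul, opW_opW hv]
  have : q = (c ^ 2 + s ^ 2) • q := by rw [h, one_smul]
  nth_rewrite 5 [this]
  module⟩

/-- The second standard basis vector as an axis of the Hopf sphere. -/
def axisY : E3 := !₂[0, 1, 0]

/-- The third standard basis vector as an axis of the Hopf sphere. -/
def axisZ : E3 := !₂[0, 0, 1]

lemma norm_axisY : ‖axisY‖ = 1 := by
  rw [← sq_eq_sq₀ (norm_nonneg _) zero_le_one, norm_sq_E3]
  simp [axisY]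

lemma norm_axisZ : ‖axisZ‖ = 1 := by
  rw [← sq_eq_sq₀ (norm_nonneg _) zero_le_one, norm_sq_E3]
  simp [axisZ]

lemma exists_displacement_axisY {c s : ℝ} (h : c ^ 2 + s ^ 2 = 1) :
    ∃ b, IsConformalDisplacement b ∧ ActsBy b (rightRot axisY c s) := by
  obtain ⟨t, rfl, rfl⟩ := exists_cosine_sine h
  refine ⟨_, (isConformalDisplacement_linearMotion (i := 1) (k := 3) (by decide) t).mul
    (isConformalDisplacement_linearMotion (i := 0) (k := 2) (by decide) t), ?_⟩
  refine (congrArg (ActsBy _) ?_).mpr ((isRotor_e13.actsBy t).mul (isRotor_e02.actsBy t))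
  ext p i
  fin_cases i <;>
    simp [rightRot_apply, rotate, opW, axisY, Matrix.vecHead, Matrix.vecTail] <;> ring

lemma exists_displacement_axisZ {c s : ℝ} (h : c ^ 2 + s ^ 2 = 1) :
    ∃ b, IsConformalDisplacement b ∧ ActsBy b (rightRot axisZ c s) := by
  obtain ⟨t, ht, ht'⟩ := exists_cosine_sine (c := c) (s := -s) (by rw [neg_sq, h])
  obtain ⟨t', rfl, rfl⟩ := exists_cosine_sine h
  refine ⟨_, (isConformalDisplacement_linearMotion (i := 0) (k := 1) (by decide) t).mul
    (isConformalDisplacement_linearMotion (i := 2) (k := 3) (by decide) t'), ?_⟩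
  refine (congrArg (ActsBy _) ?_).mpr ((isRotor_e01.actsBy t).mul (isRotor_e23.actsBy t'))
  ext p i
  fin_cases i <;>
    simp [rightRot_apply, rotate, opW, axisZ, Matrix.vecHead, Matrix.vecTail, ht, ht'] <;> ring

lemma exists_polar (a b : ℝ) : ∃ θ : ℝ, a = Real.sqrt (a ^ 2 + b ^ 2) * Real.cos θ ∧
    b = Real.sqrt (a ^ 2 + b ^ 2) * Real.sin θ := by
  have hn : ‖(⟨a, b⟩ : ℂ)‖ = Real.sqrt (a ^ 2 + b ^ 2) := by
    rw [Complex.norm_eq_sqrt_sq_add_sq]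
  refine ⟨Complex.arg ⟨a, b⟩, ?_, ?_⟩
  · rw [← hn, Complex.norm_mul_cos_arg]
  · rw [← hn, Complex.norm_mul_sin_arg]

lemma exists_angle {a b : ℝ} (h : a ^ 2 + b ^ 2 = 1) :
    ∃ θ : ℝ, Real.cos θ = a ∧ Real.sin θ = b := by
  obtain ⟨θ, h1, h2⟩ := exists_polar a b
  rw [h, Real.sqrt_one, one_mul] at h1 h2
  exact ⟨θ, h1.symm, h2.symm⟩

/-- Right multiplications commute with the Villarceau motion and act on the Hopf sphere by
rotations. Two of them, chosen by the spherical coordinates of `w`, turn `w` into `e₃`. -/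
lemma exists_displacement {w : E3} (hw : ‖w‖ = 1) :
    ∃ (b : CGA) (T : R4 →ₗ[ℝ] R4), IsConformalDisplacement b ∧ ActsBy b T ∧
      (∀ p, T p ⬝ᵥ T p = p ⬝ᵥ p) ∧ (∀ p, T (opU p) = opU (T p)) ∧ Function.Surjective T ∧
      ∀ p, hopf (T p) 2 = ⟪hopf p, w⟫ := by
  have h := norm_sq_E3 w
  rw [hw] at h
  obtain ⟨α, hα0, hα1⟩ := exists_polar (w 0) (w 1)
  have hρ := Real.sq_sqrt (add_nonneg (sq_nonneg (w 0)) (sq_nonneg (w 1)))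
  set ρ := Real.sqrt (w 0 ^ 2 + w 1 ^ 2)
  obtain ⟨β, hβ2, hβρ⟩ := exists_angle (a := w 2) (b := ρ) (by linarith)
  have half : ∀ θ : ℝ, Real.cos (θ / 2) ^ 2 + Real.sin (θ / 2) ^ 2 = 1 ∧
      Real.cos (θ / 2) ^ 2 - Real.sin (θ / 2) ^ 2 = Real.cos θ ∧
      2 * (Real.sin (θ / 2) * Real.cos (θ / 2)) = Real.sin θ := fun θ => by
    refine ⟨Real.cos_sq_add_sin_sq _, ?_, ?_⟩
    · rw [← Real.cos_two_mul', mul_div_cancel₀ _ two_ne_zero]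
    · rw [← mul_assoc, ← Real.sin_two_mul, mul_div_cancel₀ _ two_ne_zero]
  obtain ⟨a1, a2, a3⟩ := half α
  obtain ⟨b1, b2, b3⟩ := half β
  obtain ⟨g, hg, hgT⟩ := exists_displacement_axisZ a1
  obtain ⟨f, hf, hfT⟩ := exists_displacement_axisY b1
  set ca := Real.cos (α / 2)
  set sa := Real.sin (α / 2)
  set cb := Real.cos (β / 2)
  set sb := Real.sin (β / 2)
  have hY : ∀ p, hopf (rightRot axisY cb sb p) 2 =
      Real.cos β * hopf p 2 + Real.sin β * hopf p 0 := fun p => by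
    rw [← b2, ← b3]
    simp [hopf, rightRot_apply, opW, axisY]
    ring
  have hZ : ∀ p, hopf (rightRot axisZ ca sa p) 2 = hopf p 2 ∧
      hopf (rightRot axisZ ca sa p) 0 = Real.cos α * hopf p 0 + Real.sin α * hopf p 1 :=
    fun p => by
      rw [← a2, ← a3]
      simp [hopf, rightRot_apply, opW, axisZ]
      constructor
      · linear_combination (p 0 ^ 2 + p 1 ^ 2 - p 2 ^ 2 - p 3 ^ 2) * a1
      · ring
  refine ⟨f * g, rightRot axisY cb sb ∘ₗ rightRot axisZ ca sa, hf.mul hg, hfT.mul hgT,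
    fun p => ?_, fun p => ?_, ?_, fun p => ?_⟩
  · rw [LinearMap.comp_apply, rightRot_dot_self norm_axisY b1, rightRot_dot_self norm_axisZ a1]
  · simp only [LinearMap.comp_apply, rightRot_opU]
  · exact (rightRot_surjective norm_axisY b1).comp (rightRot_surjective norm_axisZ a1)
  · rw [LinearMap.comp_apply, hY, (hZ p).1, (hZ p).2, inner_E3, hα0, hα1, hβρ, hβ2]
    ring

/-! ### Ring tori of revolution and Hopf fibres -/

/-- Implicit equation of the tori of revolution with `R ^ 2 - r ^ 2 = 1`, which are the ring tori
orthogonal to the unit sphere. -/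
lemma mem_torus_iff {R r : ℝ} (hR : 0 < R) (hr : 0 < r) (hRr : R ^ 2 = 1 + r ^ 2) (c : E3) :
    c ∈ torus 0 axisZ R r ↔ (1 + ‖c‖ ^ 2) ^ 2 = 4 * R ^ 2 * (c 0 ^ 2 + c 1 ^ 2) := by
  rw [norm_sq_E3]
  constructor
  · rintro ⟨d, θ, hd, hdn, rfl⟩
    have hd2 : d 2 = 0 := by simpa [inner_E3, axisZ] using hdn
    have hd1 := norm_sq_E3 d
    rw [hd, hd2] at hd1
    have hd0 : d 0 ^ 2 = 1 - d 1 ^ 2 := by linarith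
    have hs : Real.sin θ ^ 2 = 1 - Real.cos θ ^ 2 := Real.sin_sq θ
    simp [torusPoint, axisZ, hd2, mul_pow]
    rw [hd0, hs]
    have : 1 + ((R + r * Real.cos θ) ^ 2 * (1 - d 1 ^ 2) + (R + r * Real.cos θ) ^ 2 * d 1 ^ 2 +
        r ^ 2 * (1 - Real.cos θ ^ 2)) = 2 * R * (R + r * Real.cos θ) := by
      linear_combination -hRr
    rw [this]
    ring
  · intro h
    have hρ2 := Real.sq_sqrt (add_nonneg (sq_nonneg (c 0)) (sq_nonneg (c 1)))
    have hρ0 := Real.sqrt_nonneg (c 0 ^ 2 + c 1 ^ 2)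
    set ρ := Real.sqrt (c 0 ^ 2 + c 1 ^ 2)
    have h' : 1 + (ρ ^ 2 + c 2 ^ 2) = 2 * R * ρ := by
      rw [← sq_eq_sq₀ (by positivity) (by positivity), hρ2, h, mul_pow, mul_pow, hρ2]
      ring
    have hρ : 0 < ρ := by
      refine lt_of_le_of_ne hρ0 fun h0 => ?_
      rw [← h0] at h'
      nlinarith [sq_nonneg (c 2)]
    obtain ⟨θ, h1, h2⟩ := exists_angle (a := (ρ - R) / r) (b := c 2 / r) (by
      field_simp
      linear_combination h' + hRr)
    refine ⟨!₂[c 0 / ρ, c 1 / ρ, 0], θ, ?_, ?_, ?_⟩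
    · rw [← sq_eq_sq₀ (norm_nonneg _) zero_le_one, norm_sq_E3]
      simp
      field_simp
      linarith
    · simp [inner_E3, axisZ]
    · have h3 : R + r * Real.cos θ = ρ := by rw [h1]; field_simp; ring
      have h4 : r * Real.sin θ = c 2 := by rw [h2]; field_simp
      rw [torusPoint, h3, h4]
      ext i
      fin_cases i <;> simp [axisZ] <;> field_simp

/-- The points whose Hopf image lies on a circle of latitude form a ring torus. -/
lemma setOf_hopf_eq {a b : ℝ} (ha : 0 < a) (hb : 0 < b) (hab : a ^ 2 + b ^ 2 = 1) :
    {y : OnePoint E3 | hopf (sph y) 2 = a ^ 2 - b ^ 2} =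
      (↑) '' torus 0 axisZ (1 / a) (b / a) := by
  ext y
  have hs := sph_dot_self y
  rw [dot_eq] at hs
  induction y using OnePoint.rec with
  | infty =>
    have : (-1 : ℝ) ≠ a ^ 2 - b ^ 2 := by nlinarith
    simp [hopf, sph_infty, this]
  | coe c =>
    simp only [Set.mem_ofPred_eq, Set.mem_image, OnePoint.coe_eq_coe, exists_eq_right]
    rw [mem_torus_iff (by positivity) (by positivity) (by field_simp; linarith)]
    have h : 1 + ‖c‖ ^ 2 ≠ 0 := by positivity
    have e : hopf (sph (c : OnePoint E3)) 2 =
        2 * (sph (c : OnePoint E3) 0 ^ 2 + sph (c : OnePoint E3) 1 ^ 2) - 1 := by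
      simp [hopf]
      linear_combination -hs
    have e' : sph (c : OnePoint E3) 0 ^ 2 + sph (c : OnePoint E3) 1 ^ 2 =
        4 * (c 0 ^ 2 + c 1 ^ 2) / (1 + ‖c‖ ^ 2) ^ 2 := by
      rw [sph_coe]
      simp
      field_simp
      ring
    rw [e, e', eq_sub_of_add_eq' hab]
    have ha0 := ha.ne'
    constructor <;> intro h1
    · field_simp at h1 ⊢
      linarith
    · field_simp at h1 ⊢
      linarith

/-- The plane through the centre of the torus with normal `-b d + a e₃` touches it at the points
`± (a d + b e₃)`. -/
lemma isTorusTangentPlane {a b : ℝ} (ha : 0 < a) (hab : a ^ 2 + b ^ 2 = 1) {d n : E3}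
    (hd : ‖d‖ = 1) (hn : ‖n‖ = 1) (hdn : ⟪d, n⟫ = 0) {ε : ℝ} (hε : |ε| = 1) :
    IsTorusTangentPlane 0 n (1 / a) (b / a) (ε • (a • d + b • n))
      {y | ⟪y, (-b) • d + a • n⟫ = 0} := by
  have hε2 : ε ^ 2 = 1 := by rw [← sq_abs, hε, one_pow]
  have hε0 : ε ≠ 0 := fun h => by rw [h, abs_zero] at hε; exact zero_ne_one hε
  have hnd : ⟪n, d⟫ = 0 := by rw [real_inner_comm, hdn]
  obtain ⟨θ, hc, hs⟩ := exists_angle (a := -b) (b := ε * a)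
    (by rw [mul_pow, hε2, neg_sq]; linarith)
  refine ⟨ε • d, θ, ?_, ?_, ?_, ?_⟩
  · rw [norm_smul, hd, Real.norm_eq_abs, hε, mul_one]
  · rw [real_inner_smul_left, hdn, mul_zero]
  · rw [torusPoint, hc, hs]
    match_scalars
    · field_simp
      linarith
    · field_simp
  · ext y
    have e : Real.cos θ • ε • d + Real.sin θ • n = ε • ((-b) • d + a • n) := by
      rw [hc, hs]
      module
    rw [Set.mem_ofPred_eq, Set.mem_ofPred_eq, e, real_inner_smul_right, mul_eq_zero,
      or_iff_right hε0, inner_sub_left, real_inner_smul_left]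
    have : ⟪a • d + b • n, (-b) • d + a • n⟫ = 0 := by
      simp only [inner_add_left, inner_add_right, real_inner_smul_left, real_inner_smul_right,
        hdn, hnd, real_inner_self_eq_norm_sq, hd, hn]
      ring
    rw [this, mul_zero, sub_zero]

lemma hopf_circle (p : R4) (c s : ℝ) (h : c ^ 2 + s ^ 2 = 1) :
    hopf (c • p + s • opU p) = hopf p := by
  ext i
  fin_cases i <;> simp [hopf, opU]
  · linear_combination (p 0 * p 2 + p 1 * p 3) * h
  · linear_combination (p 0 * p 3 - p 1 * p 2) * h
  · linear_combination (p 0 ^ 2 + p 1 ^ 2 - p 2 ^ 2 - p 3 ^ 2) * h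

/-- All points of a Hopf fibre lie in a plane through the origin, which is determined by the image
of the fibre under the Hopf map. -/
lemma inner_hopf_eq_zero (c : E3) :
    c 0 * hopf (sph (c : OnePoint E3)) 0 + c 1 * hopf (sph (c : OnePoint E3)) 1 +
      c 2 * (1 + hopf (sph (c : OnePoint E3)) 2) = 0 := by
  have hs := sph_dot_self (c : OnePoint E3)
  rw [dot_eq] at hs
  have h : ∀ p : R4, p 0 * p 0 + p 1 * p 1 + p 2 * p 2 + p 3 * p 3 = 1 →
      p 0 * hopf p 0 + p 1 * hopf p 1 + p 2 * (1 + hopf p 2) = 0 := fun p hp => by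
    simp [hopf]
    linear_combination -p 2 * hp
  have h1 : 1 + ‖c‖ ^ 2 ≠ 0 := by positivity
  have key := h _ hs
  have e0 : sph (c : OnePoint E3) 0 = c 0 * (2 / (1 + ‖c‖ ^ 2)) := by
    rw [sph_coe]; simp; ring
  have e1 : sph (c : OnePoint E3) 1 = c 1 * (2 / (1 + ‖c‖ ^ 2)) := by
    rw [sph_coe]; simp; ring
  have e2 : sph (c : OnePoint E3) 2 = c 2 * (2 / (1 + ‖c‖ ^ 2)) := by
    rw [sph_coe]; simp; ring
  rw [e0, e1, e2] at key
  have h2 : 2 / (1 + ‖c‖ ^ 2) ≠ 0 := by positivity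
  refine mul_left_cancel₀ h2 ?_
  linear_combination key

/-- A Hopf fibre on the ring torus is a Villarceau circle. -/
lemma isTorusVillarceauCircle {a b : ℝ} (ha : 0 < a) (hb : 0 < b) (hab : a ^ 2 + b ^ 2 = 1)
    {K : Set E3} (hK : IsEuclideanCircle K) {v : E3} (hv : ‖v‖ = 1) (hv2 : v 2 = a ^ 2 - b ^ 2)
    (hKv : ∀ c ∈ K, hopf (sph (c : OnePoint E3)) = v) :
    IsTorusVillarceauCircle 0 axisZ (1 / a) (b / a) K := by
  have hvn := norm_sq_E3 v
  rw [hv, hv2] at hvn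
  have hv01 : v 0 ^ 2 + v 1 ^ 2 = (2 * a * b) ^ 2 := by
    linear_combination -hvn - (a ^ 2 + b ^ 2 + 1) * hab
  set d : E3 := !₂[-v 0 / (2 * a * b), -v 1 / (2 * a * b), 0] with hd
  have hd1 : ‖d‖ = 1 := by
    rw [← sq_eq_sq₀ (norm_nonneg _) zero_le_one, norm_sq_E3]
    simp [hd]
    field_simp
    linarith
  have hdn : ⟪d, axisZ⟫ = 0 := by simp [inner_E3, hd, axisZ]
  refine ⟨hK, fun c hc => ?_, {y | ⟪y, (-b) • d + a • axisZ⟫ = 0}, ?_, fun c hc => ?_,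
    (1 : ℝ) • (a • d + b • axisZ), (-1 : ℝ) • (a • d + b • axisZ), fun h => ?_,
    isTorusTangentPlane ha hab hd1 norm_axisZ hdn abs_one,
    isTorusTangentPlane ha hab hd1 norm_axisZ hdn (by simp)⟩
  · have h : (c : OnePoint E3) ∈ {y : OnePoint E3 | hopf (sph y) 2 = a ^ 2 - b ^ 2} := by
      rw [Set.mem_ofPred_eq, hKv c hc, hv2]
    rw [setOf_hopf_eq ha hb hab] at h
    obtain ⟨c', hc', hcc⟩ := h
    exact OnePoint.coe_injective hcc ▸ hc'
  · exact inner_zero_left _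
  · have h := inner_hopf_eq_zero c
    rw [hKv c hc, hv2] at h
    rw [Set.mem_ofPred_eq, inner_E3]
    simp [hd, axisZ]
    field_simp
    linear_combination h + c 2 * hab
  · have := congrArg (fun u : E3 => u 2) h
    simp [hd, axisZ] at this
    linarith

/-! ### Trajectory surfaces are Dupin cyclides with the trajectory as Villarceau circle -/

/-- The displacement turning `w` into `e₃` maps the trajectory surface to a ring torus and the
trajectory to one of its Villarceau circles. -/
lemma exists_torus {w : E3} (hw : ‖w‖ = 1) {x : OnePoint E3}
    {D : OnePoint ℝ → OnePoint ℝ → OnePoint E3} {γ : OnePoint ℝ → OnePoint E3}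
    (hD : ∀ s t, sph (D s t) = torusMap w (sph x) s t) (h₁ : proj₁ w (sph x) ≠ 0)
    (h₂ : proj₂ w (sph x) ≠ 0)
    (hγ : ∀ t, sph (γ t) = cosine t • sph x + sine t • opU (sph x)) :
    ∃ b, IsConformalDisplacement b ∧ ∃ (R r : ℝ) (K : Set E3), 0 < r ∧ r < R ∧
      imageUnder b (carrier D) = (↑) '' torus 0 axisZ R r ∧
      IsTorusVillarceauCircle 0 axisZ R r K ∧ imageUnder b (Set.range γ) = (↑) '' K := by
  obtain ⟨b, T, hb, hT, hTn, hTU, hTs, hTh⟩ := exists_displacement hw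
  obtain ⟨k1, k2⟩ := abs_lt.mp (abs_inner_hopf_lt hw (sph_dot_self x) h₁ h₂)
  have hp : 0 < (1 + ⟪hopf (sph x), w⟫) / 2 := by linarith
  have hm : 0 < (1 - ⟪hopf (sph x), w⟫) / 2 := by linarith
  have ha := Real.sqrt_pos.mpr hp
  have hb' := Real.sqrt_pos.mpr hm
  have ha2 := Real.sq_sqrt hp.le
  have hb2 := Real.sq_sqrt hm.le
  set α := Real.sqrt ((1 + ⟪hopf (sph x), w⟫) / 2)
  set β := Real.sqrt ((1 - ⟪hopf (sph x), w⟫) / 2)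
  have hαβ : α ^ 2 + β ^ 2 = 1 := by linarith
  have hk : ⟪hopf (sph x), w⟫ = α ^ 2 - β ^ 2 := by linarith
  have himg : imageUnder b (carrier D) = {y | hopf (sph y) 2 = α ^ 2 - β ^ 2} := by
    rw [carrier_eq hw hD h₁ h₂]
    ext y
    constructor
    · rintro ⟨z, hz, hzy⟩
      rw [hT.mapsPoint] at hzy
      rw [Set.mem_ofPred_eq, hzy, hTh, ← hk]
      exact hz
    · intro hy
      obtain ⟨q, hq⟩ := hTs (sph y)
      obtain ⟨z, rfl⟩ := exists_sph (p := q) (by rw [← hTn, hq, sph_dot_self])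
      refine ⟨z, ?_, (hT.mapsPoint z y).mpr hq.symm⟩
      rw [Set.mem_ofPred_eq, ← hTh, hq, hk]
      exact hy
  obtain ⟨x', hx'⟩ := exists_sph (p := T (sph x)) (by rw [hTn, sph_dot_self])
  have hexγ : ∀ t, ∃ y, sph y = cosine t • sph x' + sine t • opU (sph x') := fun t =>
    exists_sph (by rw [circle_dot_self, cosine_sq_add_sine_sq, sph_dot_self, one_mul])
  choose γ' hγ' using hexγ
  have himγ : imageUnder b (Set.range γ) = Set.range γ' := by
    have h : ∀ t, T (sph (γ t)) = sph (γ' t) := fun t => by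
      rw [hγ, hγ', map_add, map_smul, map_smul, hTU, hx']
    ext y
    constructor
    · rintro ⟨_, ⟨t, rfl⟩, hy⟩
      rw [hT.mapsPoint, h] at hy
      exact ⟨t, (sph_injective hy).symm⟩
    · rintro ⟨t, rfl⟩
      exact ⟨γ t, ⟨t, rfl⟩, (hT.mapsPoint _ _).mpr (h t).symm⟩
  have hhopf : ∀ y ∈ Set.range γ', hopf (sph y) = hopf (sph x') := by
    rintro _ ⟨t, rfl⟩
    rw [hγ', hopf_circle _ _ _ (cosine_sq_add_sine_sq t)]
  have hx2 : hopf (sph x') 2 = α ^ 2 - β ^ 2 := by rw [hx', hTh, hk]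
  refine ⟨b, hb, 1 / α, β / α, ?_⟩
  have hβ1 : β < 1 := by nlinarith
  rcases isCircle_range_trajectory hγ' with ⟨K, hK, hKγ⟩ | ⟨p, v, -, h⟩
  · refine ⟨K, by positivity, by gcongr, by rw [himg, setOf_hopf_eq ha hb' hαβ],
      isTorusVillarceauCircle ha hb' hαβ hK (norm_hopf (sph_dot_self x')) hx2 fun c hc =>
        hhopf _ (hKγ ▸ Set.mem_image_of_mem _ hc), by rw [himγ, hKγ]⟩
  · -- the torus is bounded, so the fibre is not a line
    have hinf := hhopf OnePoint.infty (h ▸ Set.mem_insert _ _)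
    have h2 : hopf (sph OnePoint.infty) 2 = -1 := by simp [hopf, sph_infty]
    rw [hinf, hx2] at h2
    nlinarith

lemma exists_trajectory (x : OnePoint E3) : ∃ γ : OnePoint ℝ → OnePoint E3,
    ∀ t, sph (γ t) = cosine t • sph x + sine t • opU (sph x) := by
  have h : ∀ t, ∃ y, sph y = cosine t • sph x + sine t • opU (sph x) := fun t =>
    exists_sph (by rw [circle_dot_self, cosine_sq_add_sine_sq, sph_dot_self, one_mul])
  choose γ hγ using h
  exact ⟨γ, hγ⟩

lemma exists_trajectorySurface {w : E3} (hw : ‖w‖ = 1) (x : OnePoint E3) :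
    ∃ D : OnePoint ℝ → OnePoint ℝ → OnePoint E3, ∀ s t, sph (D s t) = torusMap w (sph x) s t := by
  have h : ∀ s t, ∃ y, sph y = torusMap w (sph x) s t := fun s t =>
    exists_sph ((hopf_torusMap hw (sph x) s t).1.trans (sph_dot_self x))
  choose D hD using h
  exact ⟨D, hD⟩

lemma torusMap_self (w : E3) (p : R4) (t : OnePoint ℝ) :
    torusMap w p t t = cosine t • p + sine t • opU p := by
  rw [torusMap, ← rot₁_add_rot₂ w p]
  nth_rewrite 5 [← proj_add w p]
  module

end Villarceau

end

theorem mainTheorem3 :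
    (∀ w : Villarceau.E3, ‖w‖ = 1 → ∀ s t : OnePoint ℝ,
      Villarceau.linearMotion (Villarceau.h₁ w) s * Villarceau.linearMotion (Villarceau.h₂ w) t =
        Villarceau.linearMotion (Villarceau.h₂ w) t *
          Villarceau.linearMotion (Villarceau.h₁ w) s) ∧
    ∀ x : OnePoint Villarceau.E3, ∃ γ : OnePoint ℝ → OnePoint Villarceau.E3,
      Villarceau.IsTrajectory x γ ∧
      Villarceau.IsCircle (Set.range γ) ∧
      ∀ w : Villarceau.E3, ‖w‖ = 1 →
        ∃ D : OnePoint ℝ → OnePoint ℝ → OnePoint Villarceau.E3,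
          Villarceau.IsTrajectorySurface w x D ∧
          (∀ t, D t t = γ t) ∧
          (¬ Villarceau.IsFixedPoint (Villarceau.h₁ w) x →
            ¬ Villarceau.IsFixedPoint (Villarceau.h₂ w) x →
            (∀ t, Villarceau.IsCircle (Set.range fun s => D s t)) ∧
            (∀ s, Villarceau.IsCircle (Set.range fun t => D s t)) ∧
            (∀ s t : ℝ, D (s : OnePoint ℝ) (t : OnePoint ℝ) ≠ OnePoint.infty →
              ContDiffAt ℝ ∞ (Villarceau.euclideanChart D) (s, t) ∧
              LinearIndependent ℝ
                ![Villarceau.partialDeriv 0 (Villarceau.euclideanChart D) (s, t),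
                  Villarceau.partialDeriv 1 (Villarceau.euclideanChart D) (s, t)] ∧
              (Villarceau.firstForm (Villarceau.euclideanChart D) (s, t)).IsDiag ∧
              (Villarceau.secondForm (Villarceau.euclideanChart D) (s, t)).IsDiag) ∧
            Villarceau.IsDupinCyclide (Villarceau.carrier D) ∧
            Villarceau.IsVillarceauCircleOn (Villarceau.carrier D) (Set.range γ) ∧
            ∀ (w' : Villarceau.E3) (D' : OnePoint ℝ → OnePoint ℝ → OnePoint Villarceau.E3),
              ‖w'‖ = 1 → Villarceau.IsTrajectorySurface w' x D' →
              Villarceau.carrier D' = Villarceau.carrier D → w' = w ∨ w' = -w) := by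
  open Villarceau in
  refine ⟨fun w _ => linearMotion_comm (h₁_mul_h₂ w), fun x => ?_⟩
  obtain ⟨γ, hγ⟩ := exists_trajectory x
  refine ⟨γ, (isTrajectory_iff x γ).mpr hγ, isCircle_range_trajectory hγ, fun w hw => ?_⟩
  obtain ⟨D, hD⟩ := exists_trajectorySurface hw x
  refine ⟨D, (isTrajectorySurface_iff hw x D).mpr hD,
    fun t => sph_injective (by rw [hD, hγ, torusMap_self]), fun hx₁ hx₂ => ?_⟩
  have p₁ := proj₁_ne_zero hw hx₁
  have p₂ := proj₂_ne_zero hw hx₂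
  obtain ⟨b, hb, R, r, K, hr, hrR, hDR, hK, hγK⟩ := exists_torus hw hD p₁ p₂ hγ
  exact ⟨isCircle_range_left hw hD p₁ p₂, isCircle_range_right hw hD p₁ p₂,
    fun s t => trajectorySurface_regular hw hD p₁ p₂,
    ⟨b, hb, 0, axisZ, norm_axisZ, Or.inl ⟨R, r, hr.trans hrR, hr, hDR⟩⟩,
    ⟨b, hb, 0, axisZ, R, r, K, norm_axisZ, hr, hrR, hDR, hK, hγK⟩,
    fun w' D' hw' hD' h => axis_unique_of_carrier_eq hw hw' hD
      ((isTrajectorySurface_iff hw' x D').mp hD') p₁ p₂ h⟩
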